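/- Let $K$ be an algebraically closed field of characteristic $2$. For a homogeneous polynomial $B \in K[x_1,x_2,x_3]$ of degree $4$ consider the quartic surface $$X_B = \{ (x,z) \in \mathbb{P}^3_K \mid z^4 + z^2 x_1^2 + B(x) = 0 \}, \qquad x = (x_1,x_2,x_3),$$ and let $\Sigma_B = \{ x \in \mathbb{P}^2_K \mid \nabla B(x) = 0 \}$ be the critical locus of $B$. A singular point of a surface in $\mathbb{P}^3$ is called a node if it is a double point whose projectivized tangent cone is a smooth conic. (1) Suppose that $X = X_B$ is normal (all its local rings are integrally closed domains). Then: (a) $\Sigma_B$ has at most $7$ points, $\mathrm{Sing}(X)$ is the inverse image of $\Sigma_B$ in $X$ under the projection $(x,z) \mapsto x$, and $X$ has at most $14$ singular points. (b) $X$ is integral, and the Gauss map $\gamma : X \dashrightarrow (\mathbb{P}^3)^\vee$, $\gamma(P) = [\nabla F(P)]$ for $P \in X \setminus \mathrm{Sing}(X)$, where $F = z^4+z^2x_1^2+B(x)$, is inseparable: the function field $K(X)$ is an algebraic, non-separable extension of the function field of $\overline{\gamma(X \setminus \mathrm{Sing}(X))}$. Moreover $\gamma$ is the composition of the projection $(x,z)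 \mapsto x$, the rational map $\mathbb{P}^2 \dashrightarrow \mathbb{P}^2$, $x \mapsto \nabla B(x)$, which has degree two, and the inclusion of the plane $y \mapsto (y,0)$; on all of $X \setminus \mathrm{Sing}(X)$ these maps are defined and the identity holds pointwise. (c) If $X$ has exactly $14$ singular points, then all of them are nodes. (2) For general $B$ (that is, for all $B$ in a nonempty Zariski open subset of the $15$-dimensional space of quartic forms), $X_B$ has exactly $14$ singular points, and all of them are nodes. -/

import Mathlib

open scoped LinearAlgebra.Projectivization

noncomputable section

namespace NormalQuartic

open MvPolynomial

/-! Homogeneous coordinates on `ℙ³` are `(x₁, x₂, x₃, z)`, with indices `0, 1, 2, 3`; those on `ℙ²`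
are `(x₁, x₂, x₃)`, with indices `0, 1, 2`. All polynomials that cut out a subset of a projective
space, or define a map on it, are homogeneous when the definitions below are applied; the choice
of the representative `P.rep` of a point `P` is then irrelevant. -/

section Hypersurfaces

variable {K : Type*} [Field K] {n : ℕ}

/-- The set of `K`-points of the projective hypersurface `F = 0`. -/
def zeroLocus (F : MvPolynomial (Fin n) K) : Set (ℙ K (Fin n → K)) :=
  {P | eval P.rep F = 0}

/-- The gradient of `F` at the vector `v`. -/
def gradAt (F : MvPolynomial (Fin n) K) (v : Fin n → K) : Fin n → K :=
  fun i => eval v (pderiv i F)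

/-- The critical locus: the points where the gradient of `F` vanishes. -/
def criticalLocus (F : MvPolynomial (Fin n) K) : Set (ℙ K (Fin n → K)) :=
  {P | gradAt F P.rep = 0}

/-- The singular points of the hypersurface `F = 0` (Jacobian criterion; the degree of `F` may be
zero in `K`, so that `F(P) = 0` has to be required as well). -/
def singularLocus (F : MvPolynomial (Fin n) K) : Set (ℙ K (Fin n → K)) :=
  {P | P ∈ zeroLocus F ∧ P ∈ criticalLocus F}

/-- The equation of the hypersurface `F = 0` in the affine chart where the `i`-th homogeneous
coordinate equals `1`. -/
def chartEquation (F : MvPolynomial (Fin n) K) (i : Fin n) : MvPolynomial {j : Fin n // j ≠ i} K :=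
  aeval (fun j => if h : j = i then 1 else X ⟨j, h⟩) F

/-- The affine coordinate ring of the hypersurface `F = 0` in the `i`-th chart. -/
abbrev ChartRing (F : MvPolynomial (Fin n) K) (i : Fin n) : Type _ :=
  MvPolynomial {j : Fin n // j ≠ i} K ⧸ Ideal.span {chartEquation F i}

/-- The hypersurface (scheme) `F = 0` is normal: all its local rings, that is, the localizations
of its affine coordinate rings at prime ideals, are integrally closed domains. -/
def IsNormal (F : MvPolynomial (Fin n) K) : Prop :=
  ∀ (i : Fin n) (p : Ideal (ChartRing F i)) [p.IsPrime],
    IsDomain (Localization.AtPrime p) ∧ IsIntegrallyClosed (Localization.AtPrime p)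

/-- The Taylor expansion `f(a + y)` of an affine equation `f` at the point `a`. -/
def translate {σ : Type*} (a : σ → K) (f : MvPolynomial σ K) : MvPolynomial σ K :=
  aeval (fun j => X j + C (a j)) f

/-- The projective quadric `q = 0` is smooth. -/
def IsSmoothQuadric {σ : Type*} (q : MvPolynomial σ K) : Prop :=
  ∀ v : σ → K, v ≠ 0 → ¬ (eval v q = 0 ∧ ∀ j, eval v (pderiv j q) = 0)

/-- `P` is a node of the hypersurface `F = 0`: in an affine chart around `P`, the Taylor expansion
of the equation at `P` starts in degree two, with a quadratic form that defines a smooth quadric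
(the projectivized tangent cone). This does not depend on the chart. -/
def IsNode (F : MvPolynomial (Fin n) K) (P : ℙ K (Fin n → K)) : Prop :=
  ∃ i : Fin n, P.rep i ≠ 0 ∧
    let f := translate (fun j : {j : Fin n // j ≠ i} => P.rep j / P.rep i) (chartEquation F i)
    homogeneousComponent 0 f = 0 ∧ homogeneousComponent 1 f = 0 ∧
      IsSmoothQuadric (homogeneousComponent 2 f)

/-- The gradient map `P ↦ [∇F(P)]`, on the complement of the critical locus. -/
def gradientMap (F : MvPolynomial (Fin n) K) (P : ℙ K (Fin n → K)) (hP : P ∉ criticalLocus F) :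
    ℙ K (Fin n → K) :=
  Projectivization.mk K (gradAt F P.rep) hP

/-- The Gauss map `P ↦ [∇F(P)]` of the hypersurface `X = {F = 0}`, defined on `X \ Sing X`, with
values in the dual projective space (in dual coordinates). -/
def gaussMap (F : MvPolynomial (Fin n) K)
    (P : {P : ℙ K (Fin n → K) // P ∈ zeroLocus F ∧ P ∉ singularLocus F}) : ℙ K (Fin n → K) :=
  gradientMap F P.1 fun h => P.2.2 ⟨P.2.1, h⟩

end Hypersurfaces

section FunctionFields

variable (K : Type*) [Field K]

/-- The subfield `K(gᵢ / gⱼ : i, j)` of `L`, generated by all quotients of members of `g`.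
If `g` lists the homogeneous coordinates in the fraction field of the homogeneous coordinate ring
of an integral projective variety `X`, this is the function field of `X`. If `g` lists
homogeneous forms of equal degree, not all zero on `X`, which define a rational map `φ` from `X`
to a projective space, this is the function field of the closure of the image of `φ`, embedded by
`φ^*` into the function field of `X`. -/
def quotientField {L ι : Type*} [Field L] [Algebra K L] (g : ι → L) : IntermediateField K L :=
  IntermediateField.adjoin K {a | ∃ i j, a = g i / g j}

variable {K} {n : ℕ}

/-- The degree of the gradient map `x ↦ ∇B(x)` as a rational map from projective space to the
closure of its image: the degree of the extension of function fields (it is `0` if that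
extension is infinite). The first field is contained in the second, since the partial derivatives
are forms of equal degree; `relfinrank` is then the degree of the extension. -/
def gradientMapDegree (B : MvPolynomial (Fin n) K) : ℕ :=
  let L := FractionRing (MvPolynomial (Fin n) K)
  IntermediateField.relfinrank
    (quotientField K fun i => algebraMap (MvPolynomial (Fin n) K) L (pderiv i B))
    (quotientField K fun i => algebraMap (MvPolynomial (Fin n) K) L (X i))

/-- The homogeneous coordinate ring of the hypersurface `F = 0`. -/
abbrev CoordRing (F : MvPolynomial (Fin n) K) : Type _ :=
  MvPolynomial (Fin n) K ⧸ Ideal.span {F}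

/-- The hypersurface `X = {F = 0}` is integral, and its Gauss map is inseparable: the function
field of `X` is an algebraic extension of the function field of the closure of the image of the
Gauss map, and it is not separable over it. -/
def GaussMapInseparable (F : MvPolynomial (Fin n) K) : Prop :=
  ∃ _ : IsDomain (CoordRing F),
    let L := FractionRing (CoordRing F)
    let toL : MvPolynomial (Fin n) K → L :=
      fun G => algebraMap (CoordRing F) L (Ideal.Quotient.mk _ G)
    let KX : IntermediateField K L := quotientField K fun i => toL (X i)
    let E : IntermediateField K L := quotientField K fun i => toL (pderiv i F)
    (∀ a ∈ KX, IsAlgebraic E a) ∧ ∃ a ∈ KX, ¬ IsSeparable E a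

end FunctionFields

section Quartic

variable {K : Type*} [Field K]

/-- The quartic form `z⁴ + z² x₁² + B(x)`. -/
def quartic (B : MvPolynomial (Fin 3) K) : MvPolynomial (Fin 4) K :=
  X 3 ^ 4 + X 3 ^ 2 * X 0 ^ 2 + rename Fin.castSucc B

/-- The coordinates `x = (x₁, x₂, x₃)` of a representative of a point of `ℙ³`. -/
def xPart (P : ℙ K (Fin 4 → K)) : Fin 3 → K := fun i => P.rep i.castSucc

/-- The projection `(x, z) ↦ x` from `ℙ³` to `ℙ²`, defined where `x ≠ 0`. -/
def proj (P : ℙ K (Fin 4 → K)) (hP : xPart P ≠ 0) : ℙ K (Fin 3 → K) :=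
  Projectivization.mk K (xPart P) hP

/-- The inclusion `y ↦ (y, 0)` of `ℙ²` into `ℙ³`. -/
def planeInclusion : ℙ K (Fin 3 → K) → ℙ K (Fin 4 → K) :=
  fun Q => Projectivization.mk K (Fin.snoc Q.rep 0 : Fin 4 → K) fun h =>
    Q.rep_nonzero <| funext fun i => by
      have := congrFun h i.castSucc
      rwa [Fin.snoc_castSucc] at this

/-- The monomials of degree four in three variables. -/
abbrev QuarticMonomial : Type := {m : Fin 3 →₀ ℕ // m.degree = 4}

/-- The property `p` holds for a general quartic form in three variables: it holds on a set
`Φ ≠ 0`, where `Φ` is a nonzero polynomial in the 15 coefficients of the form. -/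
def ForGeneralQuarticForm (p : MvPolynomial (Fin 3) K → Prop) : Prop :=
  ∃ Φ : MvPolynomial QuarticMonomial K, Φ ≠ 0 ∧
    ∀ B : MvPolynomial (Fin 3) K, B.IsHomogeneous 4 →
      eval (fun m : QuarticMonomial => coeff m.1 B) Φ ≠ 0 → p B

end Quartic

end NormalQuartic

end

/-! In characteristic two, a quartic form in three variables is determined, up to a combination of
squares of monomials, by the nine coefficients `M i j` of the monomials `xₚ x_q xⱼ²`, where
`{i, p, q} = {0, 1, 2}` (`exists_eq_quarticForm`).
Its gradient is the cross product `x × φ(x)`, where `φ(x) = M x⁽²⁾` is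
additive and semilinear for the Frobenius map (`pderiv_quarticForm`). Hence `Σ_B` is the set of
eigenlines of `φ`, and everything follows from the semilinear algebra of `φ`.

If `M` has rank at most one, the equation of the surface has the form `G² + l² q` with a linear
form `l`, and `G / l` is integral over the coordinate ring but not in it; so normality excludes
this case (`not_exists_eq_vecMulVec_of_isNormal`). Otherwise `det (x, φ x, φ² x)` does not vanish
identically, by polarization (`exists_cyclicDet_ne_zero`), and `φ` has a cyclic vector `v`. In the
basis `v, φ v, φ² v` the nonzero vectors fixed by `φ` correspond to the roots of an explicit
separable polynomial of degree at most seven.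
Every eigenline with nonzero eigenvalue contains exactly one
nonzero fixed vector, and the kernel of `φ` is at most a line. There are seven eigenlines if `φ` is
injective (as in `ℙ²(𝔽₂)`, the case where `φ` is the Frobenius map), and at most four otherwise.

The fibre of the surface over a point of the plane is `z = r` or `z = r + x₁`, so each critical
point carries two singular points, or one if `x₁ = 0` (`encard_singularLocus`). In the chart
`x₁ = 1` the mixed second derivative of `B` at a critical point is the first coordinate of `φ`,
which is nonzero if `φ` is injective; this gives the nodes.
For general `B`, it suffices that `det M ≠ 0` and that a
second polynomial in `M`, which excludes critical points with `x₁ = 0`, does not vanish.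

The surface is integral, because a factorization of its equation would write `B` as `s² + x₁² t`,
and the gradient would vanish on a line (`irreducible_quartic`). With `y = x × φ(x)` and `w = Mᵀ y`
the identity `w × y⁽²⁾ = det (x, φ x, φ² x) x⁽²⁾` shows that the squares of the `xᵢ / xⱼ` are
rational functions of the `yᵢ / yⱼ` (`vecMul_cross_sq`). Since `x` is orthogonal to `y`, one of
these square roots generates `K(xᵢ / xⱼ)`, and it is not in `K(yᵢ / yⱼ)`, because the derivation
`∑ φᵢ ∂ᵢ` kills every `yᵢ` (`relfinrank_quotientField`). The Gauss map is inseparable, because the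
derivation `∂/∂z` of the function field of the surface kills all partial derivatives of the
equation but not `z / x₁` (`gaussMapInseparable`). -/

noncomputable section

namespace NormalQuartic

open MvPolynomial

/-! ### The Frobenius-semilinear map attached to a matrix -/

section FrobeniusMap

open Matrix

/-- The map `x ↦ M x⁽²⁾`, where `x⁽²⁾` is the vector of the squares of the coordinates of `x`.
In characteristic two it is additive, and semilinear for the Frobenius. -/
def frobMul {A : Type*} [CommRing A] (M : Matrix (Fin 3) (Fin 3) A) (x : Fin 3 → A) : Fin 3 → A :=
  fun i => ∑ j, M i j * x j ^ 2

lemma frobMul_add {A : Type*} [CommRing A] [CharP A 2] (M : Matrix (Fin 3) (Fin 3) A)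
    (x y : Fin 3 → A) : frobMul M (x + y) = frobMul M x + frobMul M y := by
  funext i
  simp only [frobMul, Pi.add_apply, CharTwo.add_sq, mul_add, Finset.sum_add_distrib]

lemma frobMul_smul {A : Type*} [CommRing A] (M : Matrix (Fin 3) (Fin 3) A) (c : A)
    (x : Fin 3 → A) : frobMul M (c • x) = c ^ 2 • frobMul M x := by
  funext i
  simp only [frobMul, Pi.smul_apply, smul_eq_mul, Finset.mul_sum]
  exact Finset.sum_congr rfl fun j _ => by ring

/-- The triple product `det (x, φ x, φ² x)` for `φ x = M x⁽²⁾`; it is nonzero exactly if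
`x` is a cyclic vector for `φ`. -/
def cyclicDet {A : Type*} [CommRing A] (M : Matrix (Fin 3) (Fin 3) A) (x : Fin 3 → A) : A :=
  x ⬝ᵥ (frobMul M x ⨯₃ frobMul M (frobMul M x))

lemma eq_zero_of_forall_sum_mul_pow_eq_zero {K : Type*} [Field K] [Infinite K] {n : ℕ}
    (c : Fin n → K) (h : ∀ s : K, ∑ k, c k * s ^ (k : ℕ) = 0) (k : Fin n) : c k = 0 := by
  have hp : (∑ k : Fin n, Polynomial.monomial (k : ℕ) (c k)) = 0 :=
    Polynomial.funext fun s => by simpa [Polynomial.eval_finsetSum] using h s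
  have := congrArg (fun p => p.coeff (k : ℕ)) hp
  simpa [Polynomial.finsetSum_coeff, Polynomial.coeff_monomial, Fin.val_inj] using this

lemma exists_eq_smul_of_cross_eq_zero {K : Type*} [Field K] {n a : Fin 3 → K} (hn : n ≠ 0)
    (h : n ⨯₃ a = 0) : ∃ c : K, a = c • n := by
  by_contra hc
  push Not at hc
  refine crossProduct_ne_zero_iff_linearIndependent.2 ?_ h
  rw [LinearIndependent.pair_iff' hn]
  exact fun c hca => hc c hca.symm

variable {K : Type*} [Field K]

lemma eq_vecMulVec_of_cross_col {M : Matrix (Fin 3) (Fin 3) K} {n : Fin 3 → K} (hn : n ≠ 0)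
    (h : ∀ j, n ⨯₃ (fun i => M i j) = 0) : ∃ u m, M = vecMulVec u m := by
  choose c hc using fun j => exists_eq_smul_of_cross_eq_zero hn (h j)
  refine ⟨n, c, ?_⟩
  ext i j
  have := congrFun (hc j) i
  simp only [Pi.smul_apply, smul_eq_mul] at this
  rw [vecMulVec_apply, this, mul_comm]

lemma frobMul_single (M : Matrix (Fin 3) (Fin 3) K) (j : Fin 3) :
    frobMul M (Pi.single j 1) = fun i => M i j := by
  funext i
  simp [frobMul, Pi.single_apply]

variable [CharP K 2]

/-- If `φ² = 0` for `φ x = M x⁽²⁾`, then `M` has rank at most one: two independent rows of `M`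
would determine the squares of all columns up to scalars. -/
lemma eq_vecMulVec_of_frobMul_frobMul [PerfectRing K 2] {M : Matrix (Fin 3) (Fin 3) K}
    (h : ∀ x, frobMul M (frobMul M x) = 0) : ∃ u m, M = vecMulVec u m := by
  by_cases hr : ∃ i j, M i ⨯₃ M j ≠ 0
  · obtain ⟨i, j, hij⟩ := hr
    have hcol : ∀ k l, ∑ p, M l p * M p k ^ 2 = 0 := fun k l => by
      have := congrFun (h (Pi.single k 1)) l
      rwa [frobMul_single] at this
    have key : ∀ k, ∃ t, (fun p => M p k ^ 2) = t • (M i ⨯₃ M j) := fun k => by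
      refine exists_eq_smul_of_cross_eq_zero hij ?_
      have h1 := hcol k i
      have h2 := hcol k j
      simp only [Fin.sum_univ_three] at h1 h2
      rw [cross_apply, cross_apply]
      funext p
      fin_cases p <;> simp
      · linear_combination M j 0 * h1 - M i 0 * h2
      · linear_combination M j 1 * h1 - M i 1 * h2
      · linear_combination M j 2 * h1 - M i 2 * h2
    choose t ht using key
    refine ⟨fun p => (frobeniusEquiv K 2).symm ((M i ⨯₃ M j) p),
      fun k => (frobeniusEquiv K 2).symm (t k), ?_⟩
    ext p k
    refine CharTwo.sq_injective ?_
    have h1 := congrFun (ht k) p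
    simp only [Pi.smul_apply, smul_eq_mul] at h1
    simp only [vecMulVec_apply, mul_pow, frobeniusEquiv_symm_pow_p]
    rw [h1, mul_comm]
  · push Not at hr
    by_cases hM : ∃ i, M i ≠ 0
    · obtain ⟨i, hi⟩ := hM
      choose u hu using fun j => exists_eq_smul_of_cross_eq_zero hi (hr i j)
      exact ⟨u, M i, by ext p k; rw [hu p]; simp [vecMulVec_apply]⟩
    · push Not at hM
      exact ⟨0, 0, by ext p k; simp [hM p, vecMulVec_apply]⟩

/-- A Frobenius-semilinear map of rank at least two has a cyclic vector. If
`det (x, φ x, φ² x)` vanishes identically, then polarization (comparison of the coefficients of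
`s` and `s²` after the substitution of `x + s y` for `x`) gives `φ y ∥ φ² x` for all `x, y`. -/
lemma exists_cyclicDet_ne_zero [IsAlgClosed K] {M : Matrix (Fin 3) (Fin 3) K}
    (hM : ¬ ∃ u m, M = vecMulVec u m) : ∃ x, cyclicDet M x ≠ 0 := by
  by_contra! H
  have : Infinite K := IsAlgClosed.instInfinite
  have h1 : ∀ x, frobMul M x ⨯₃ frobMul M (frobMul M x) = 0 := by
    intro x
    rw [← dotProduct_eq_zero_iff]
    intro y
    set f := frobMul M x
    set g := frobMul M f
    set f' := frobMul M y
    set g' := frobMul M f'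
    rw [dotProduct_comm]
    refine eq_zero_of_forall_sum_mul_pow_eq_zero (n := 8) ![x ⬝ᵥ (f ⨯₃ g), y ⬝ᵥ (f ⨯₃ g),
      x ⬝ᵥ (f' ⨯₃ g), y ⬝ᵥ (f' ⨯₃ g), x ⬝ᵥ (f ⨯₃ g'), y ⬝ᵥ (f ⨯₃ g'), x ⬝ᵥ (f' ⨯₃ g'),
      y ⬝ᵥ (f' ⨯₃ g')] (fun s => ?_) 1
    have := H (x + s • y)
    simp only [cyclicDet, frobMul_add, frobMul_smul] at this
    rw [← this]
    simp [Fin.sum_univ_succ, f, g, f', g']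
    ring
  have h2 : ∀ x y, frobMul M (frobMul M x) ⨯₃ frobMul M y = 0 := by
    intro x y
    rw [← cross_anticomm, neg_eq_zero]
    set f := frobMul M x with hf
    set g := frobMul M f with hg
    set f' := frobMul M y with hf'
    set g' := frobMul M f' with hg'
    funext i
    refine eq_zero_of_forall_sum_mul_pow_eq_zero (n := 7) ![(f ⨯₃ g) i, 0,
      (f' ⨯₃ g) i, 0, (f ⨯₃ g') i, 0, (f' ⨯₃ g') i] (fun s => ?_) 2
    have := congrFun (h1 (x + s • y)) i
    simp only [frobMul_add, frobMul_smul, ← hf, ← hf', ← hg, ← hg'] at this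
    simp only [map_add, map_smul, LinearMap.add_apply, LinearMap.smul_apply, Pi.add_apply,
      Pi.smul_apply, smul_eq_mul, Pi.zero_apply] at this
    refine Eq.trans ?_ this
    simp [Fin.sum_univ_succ]
    ring
  by_cases h3 : ∃ x, frobMul M (frobMul M x) ≠ 0
  · obtain ⟨x, hx⟩ := h3
    refine hM (eq_vecMulVec_of_cross_col hx fun j => ?_)
    rw [← frobMul_single]
    exact h2 x _
  · push Not at h3
    exact hM (eq_vecMulVec_of_frobMul_frobMul h3)

end FrobeniusMap

/-! ### Counting the eigenlines of a Frobenius-semilinear map -/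

section Eigenlines

open Matrix

variable {K : Type*} [Field K]

/-- The lines of `K³` that are mapped into themselves by `x ↦ M x⁽²⁾`, as points of `ℙ²`. -/
def eigenlines (M : Matrix (Fin 3) (Fin 3) K) : Set (ℙ K (Fin 3 → K)) :=
  {Q | Q.rep ⨯₃ frobMul M Q.rep = 0}

lemma mk_mem_eigenlines_iff {M : Matrix (Fin 3) (Fin 3) K} {x : Fin 3 → K} (hx : x ≠ 0) :
    Projectivization.mk K x hx ∈ eigenlines M ↔ x ⨯₃ frobMul M x = 0 := by
  obtain ⟨a, ha⟩ := Projectivization.exists_smul_eq_mk_rep K x hx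
  rw [eigenlines, Set.mem_ofPred_eq, ← ha, Units.smul_def, frobMul_smul]
  simp

/-- The polynomial `a₀⁴ T⁷ + a₁² T³ + a₂ T + 1`. If `v` is a cyclic vector of the semilinear map
`φ` and `φ³ v = a₀ v + a₁ φ v + a₂ φ² v`, its roots are the last coordinates of the nonzero fixed
vectors of `φ` with respect to the basis `v, φ v, φ² v`. -/
def fixedPoly (a : Fin 3 → K) : Polynomial K :=
  Polynomial.C (a 0 ^ 4) * Polynomial.X ^ 7 + Polynomial.C (a 1 ^ 2) * Polynomial.X ^ 3 +
    Polynomial.C (a 2) * Polynomial.X + 1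

lemma eval_fixedPoly (a : Fin 3 → K) (t : K) :
    (fixedPoly a).eval t = a 0 ^ 4 * t ^ 7 + a 1 ^ 2 * t ^ 3 + a 2 * t + 1 := by
  simp [fixedPoly]

lemma fixedPoly_ne_zero (a : Fin 3 → K) : fixedPoly a ≠ 0 := fun h => by
  have := eval_fixedPoly a 0
  simp [h] at this

lemma natDegree_fixedPoly {a : Fin 3 → K} (ha : a 0 ≠ 0) : (fixedPoly a).natDegree = 7 := by
  unfold fixedPoly
  compute_degree!

lemma natDegree_fixedPoly_le_of_eq_zero {a : Fin 3 → K} (ha : a 0 = 0) :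
    (fixedPoly a).natDegree ≤ 3 := by
  unfold fixedPoly
  rw [ha]
  simp only [ne_eq, OfNat.ofNat_ne_zero, not_false_eq_true, zero_pow, map_zero, zero_mul, zero_add]
  compute_degree

lemma separable_fixedPoly [CharP K 2] (a : Fin 3 → K) : (fixedPoly a).Separable := by
  refine ⟨1, Polynomial.X, ?_⟩
  have h2 : (2 : Polynomial K) = 0 := CharTwo.two_eq_zero
  simp only [fixedPoly, Polynomial.derivative_add, Polynomial.derivative_mul,
    Polynomial.derivative_C, Polynomial.derivative_X_pow, Polynomial.derivative_X,
    Polynomial.derivative_one]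
  simp only [map_natCast]
  push_cast
  linear_combination (4 * Polynomial.C (a 0 ^ 4) * Polynomial.X ^ 7 +
    2 * Polynomial.C (a 1 ^ 2) * Polynomial.X ^ 3 + Polynomial.C (a 2) * Polynomial.X) * h2

open Classical in
lemma card_roots_fixedPoly [IsAlgClosed K] [CharP K 2] {a : Fin 3 → K} (ha : a 0 ≠ 0) :
    (fixedPoly a).roots.toFinset.card = 7 := by
  rw [Multiset.toFinset_card_of_nodup (Polynomial.nodup_roots (separable_fixedPoly a)),
    ← natDegree_fixedPoly ha]
  exact (IsAlgClosed.splits (fixedPoly a)).natDegree_eq_card_roots.symm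

lemma exists_frobMul_eq_smul {Q : ℙ K (Fin 3 → K)} (hQ : Q ∈ eigenlines M) :
    ∃ μ : K, frobMul M Q.rep = μ • Q.rep :=
  exists_eq_smul_of_cross_eq_zero Q.rep_nonzero hQ

/-- A basis `v, φ v, φ² v` of `K³`, together with the coordinates of `φ³ v`. -/
structure CyclicBasis (M : Matrix (Fin 3) (Fin 3) K) where
  basis : Module.Basis (Fin 3) K (Fin 3 → K)
  coord : Fin 3 → K
  map_zero : frobMul M (basis 0) = basis 1
  map_one : frobMul M (basis 1) = basis 2
  map_two : frobMul M (basis 2) = coord 0 • basis 0 + coord 1 • basis 1 + coord 2 • basis 2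

lemma exists_cyclicBasis {M : Matrix (Fin 3) (Fin 3) K} {x : Fin 3 → K}
    (hx : cyclicDet M x ≠ 0) : Nonempty (CyclicBasis M) := by
  rw [cyclicDet, triple_product_eq_det] at hx
  have hli : LinearIndependent K ![x, frobMul M x, frobMul M (frobMul M x)] :=
    Matrix.linearIndependent_rows_of_det_ne_zero hx
  let b := basisOfLinearIndependentOfCardEqFinrank hli (by simp)
  have hb : ∀ i, b i = ![x, frobMul M x, frobMul M (frobMul M x)] i := fun i => by
    simp [b]
  refine ⟨⟨b, b.repr (frobMul M (b 2)), by simp [hb], by simp [hb], ?_⟩⟩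
  rw [← Fin.sum_univ_three (fun i => b.repr (frobMul M (b 2)) i • b i), b.sum_repr]

namespace CyclicBasis

variable {M : Matrix (Fin 3) (Fin 3) K} (b : CyclicBasis M)

/-- The vector with coordinates `a₀ t², a₀² t⁴ + a₁ t², t`. -/
def fixedVector (t : K) : Fin 3 → K :=
  (b.coord 0 * t ^ 2) • b.basis 0 + (b.coord 0 ^ 2 * t ^ 4 + b.coord 1 * t ^ 2) • b.basis 1 +
    t • b.basis 2

lemma ext_coord {c d : Fin 3 → K}
    (h : c 0 • b.basis 0 + c 1 • b.basis 1 + c 2 • b.basis 2 =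
      d 0 • b.basis 0 + d 1 • b.basis 1 + d 2 • b.basis 2) (i : Fin 3) : c i = d i := by
  rw [← Fin.sum_univ_three (fun i => c i • b.basis i),
    ← Fin.sum_univ_three (fun i => d i • b.basis i)] at h
  have := congrArg (fun v => b.basis.repr v i) h
  simpa [Finsupp.single_apply] using this

lemma exists_coord (x : Fin 3 → K) :
    ∃ c : Fin 3 → K, x = c 0 • b.basis 0 + c 1 • b.basis 1 + c 2 • b.basis 2 :=
  ⟨b.basis.repr x, by
    rw [← Fin.sum_univ_three (fun i => b.basis.repr x i • b.basis i), b.basis.sum_repr]⟩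

lemma fixedVector_eq (t : K) : b.fixedVector t =
    (![b.coord 0 * t ^ 2, b.coord 0 ^ 2 * t ^ 4 + b.coord 1 * t ^ 2, t] : Fin 3 → K) 0 • b.basis 0 +
      (![b.coord 0 * t ^ 2, b.coord 0 ^ 2 * t ^ 4 + b.coord 1 * t ^ 2, t] : Fin 3 → K) 1 •
        b.basis 1 +
      (![b.coord 0 * t ^ 2, b.coord 0 ^ 2 * t ^ 4 + b.coord 1 * t ^ 2, t] : Fin 3 → K) 2 •
        b.basis 2 := by
  simp [fixedVector]

lemma fixedVector_injective : Function.Injective b.fixedVector := fun s t h => by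
  rw [fixedVector_eq, fixedVector_eq] at h
  simpa using b.ext_coord h 2

lemma fixedVector_ne_zero {t : K} (ht : t ≠ 0) : b.fixedVector t ≠ 0 := fun h =>
  ht (b.fixedVector_injective (h.trans (by simp [fixedVector])))

lemma ne_zero_of_isRoot {a : Fin 3 → K} {t : K} (ht : (fixedPoly a).eval t = 0) : t ≠ 0 := by
  rintro rfl
  simp [eval_fixedPoly] at ht

/-- The line spanned by `fixedVector t` (an arbitrary point if `t = 0`). -/
def fixedLine (t : K) : ℙ K (Fin 3 → K) :=
  open Classical in
  if ht : t = 0 then Projectivization.mk K (b.basis 0) (b.basis.ne_zero 0)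
  else Projectivization.mk K (b.fixedVector t) (b.fixedVector_ne_zero ht)

lemma fixedLine_of_isRoot {t : K} (ht : (fixedPoly b.coord).eval t = 0) : b.fixedLine t =
    Projectivization.mk K (b.fixedVector t) (b.fixedVector_ne_zero (ne_zero_of_isRoot ht)) := by
  rw [fixedLine, dif_neg (ne_zero_of_isRoot ht)]

lemma setOf_eval_eq_zero : {t | (fixedPoly b.coord).eval t = 0} =
    (open Classical in ((fixedPoly b.coord).roots.toFinset : Set K)) := by
  ext t
  simp [fixedPoly_ne_zero]

lemma encard_roots_le {n : ℕ} (h : (fixedPoly b.coord).natDegree ≤ n) :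
    {t | (fixedPoly b.coord).eval t = 0}.encard ≤ n := by
  classical
  rw [setOf_eval_eq_zero, Set.encard_coe_eq_coe_finsetCard]
  exact_mod_cast (Multiset.toFinset_card_le _).trans ((Polynomial.card_roots' _).trans h)

variable [CharP K 2]

lemma frobMul_coord (c : Fin 3 → K) :
    frobMul M (c 0 • b.basis 0 + c 1 • b.basis 1 + c 2 • b.basis 2) =
      (c 2 ^ 2 * b.coord 0) • b.basis 0 + (c 0 ^ 2 + c 2 ^ 2 * b.coord 1) • b.basis 1 +
        (c 1 ^ 2 + c 2 ^ 2 * b.coord 2) • b.basis 2 := by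
  simp only [frobMul_add, frobMul_smul, b.map_zero, b.map_one, b.map_two]
  module

/-- The equation `φ x = μ x` in coordinates. -/
lemma frobMul_eq_smul_iff (c : Fin 3 → K) (μ : K) :
    frobMul M (c 0 • b.basis 0 + c 1 • b.basis 1 + c 2 • b.basis 2) =
        μ • (c 0 • b.basis 0 + c 1 • b.basis 1 + c 2 • b.basis 2) ↔
      c 2 ^ 2 * b.coord 0 = μ * c 0 ∧ c 0 ^ 2 + c 2 ^ 2 * b.coord 1 = μ * c 1 ∧
        c 1 ^ 2 + c 2 ^ 2 * b.coord 2 = μ * c 2 := by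
  rw [b.frobMul_coord]
  constructor
  · intro h
    have := b.ext_coord (c := ![_, _, _]) (d := ![μ * c 0, μ * c 1, μ * c 2])
      (h.trans (by simp [smul_add, smul_smul]))
    exact ⟨this 0, this 1, this 2⟩
  · rintro ⟨h0, h1, h2⟩
    rw [h0, h1, h2]
    simp [smul_add, smul_smul]

lemma frobMul_fixedVector {t : K} (ht : (fixedPoly b.coord).eval t = 0) :
    frobMul M (b.fixedVector t) = b.fixedVector t := by
  have h2 : (2 : K) = 0 := CharTwo.two_eq_zero
  rw [eval_fixedPoly] at ht
  have := (b.frobMul_eq_smul_iff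
    ![b.coord 0 * t ^ 2, b.coord 0 ^ 2 * t ^ 4 + b.coord 1 * t ^ 2, t] 1).2 ?_
  · rwa [one_smul, ← fixedVector_eq] at this
  · simp only [one_mul]
    refine ⟨mul_comm _ _, ?_, ?_⟩ <;> simp
    · ring
    · linear_combination t * ht + (b.coord 0 ^ 2 * t ^ 4 * b.coord 1 * t ^ 2 - t) * h2

/-- A vector fixed by `φ` is determined by its last coordinate, a root of `fixedPoly`. -/
lemma exists_root_of_frobMul_eq {x : Fin 3 → K} (hx : x ≠ 0) (h : frobMul M x = x) :
    ∃ t, (fixedPoly b.coord).eval t = 0 ∧ x = b.fixedVector t := by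
  have h2 : (2 : K) = 0 := CharTwo.two_eq_zero
  obtain ⟨c, rfl⟩ := b.exists_coord x
  obtain ⟨e0, e1, e2⟩ := (b.frobMul_eq_smul_iff c 1).1 (by rw [one_smul, h])
  rw [one_mul] at e0 e1 e2
  have hc0 : c 0 = b.coord 0 * c 2 ^ 2 := by rw [← e0, mul_comm]
  have hc1 : c 1 = b.coord 0 ^ 2 * c 2 ^ 4 + b.coord 1 * c 2 ^ 2 := by
    rw [← e1, hc0]
    ring
  have ht : c 2 ≠ 0 := fun h0 => hx (by simp [hc1, hc0, h0])
  refine ⟨c 2, ?_, ?_⟩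
  · rw [eval_fixedPoly]
    refine mul_left_cancel₀ ht ?_
    rw [hc1] at e2
    linear_combination e2 + (c 2 - b.coord 0 ^ 2 * c 2 ^ 4 * b.coord 1 * c 2 ^ 2) * h2
  · rw [fixedVector, ← hc0, ← hc1]

lemma frobMul_ne_zero (h0 : b.coord 0 ≠ 0) {x : Fin 3 → K} (hx : x ≠ 0) : frobMul M x ≠ 0 := by
  intro h
  obtain ⟨c, rfl⟩ := b.exists_coord x
  obtain ⟨e0, e1, e2⟩ := (b.frobMul_eq_smul_iff c 0).1 (by rw [zero_smul, h])
  simp only [zero_mul, mul_eq_zero, pow_eq_zero_iff, ne_eq, OfNat.ofNat_ne_zero,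
    not_false_eq_true, h0, or_false] at e0
  simp only [e0, ne_eq, OfNat.ofNat_ne_zero, not_false_eq_true, zero_pow, zero_mul, add_zero,
    pow_eq_zero_iff] at e1 e2
  exact hx (by simp [e0, e1, e2])

/-- The eigenlines with nonzero eigenvalue are spanned by the fixed vectors. -/
lemma mem_image_fixedLine_of_frobMul_eq_smul {x : Fin 3 → K} (hx : x ≠ 0) {μ : K} (hμ : μ ≠ 0)
    (h : frobMul M x = μ • x) :
    Projectivization.mk K x hx ∈ b.fixedLine '' {t | (fixedPoly b.coord).eval t = 0} := by
  have hx' : μ⁻¹ • x ≠ 0 := smul_ne_zero (inv_ne_zero hμ) hx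
  obtain ⟨t, ht, e⟩ := b.exists_root_of_frobMul_eq hx' (by
    rw [frobMul_smul, h, smul_smul, pow_two, mul_assoc, inv_mul_cancel₀ hμ, mul_one])
  refine ⟨t, ht, ?_⟩
  rw [b.fixedLine_of_isRoot ht, Projectivization.mk_eq_mk_iff']
  exact ⟨μ⁻¹, e⟩

lemma eigenlines_subset_image (h0 : b.coord 0 ≠ 0) :
    eigenlines M ⊆ b.fixedLine '' {t | (fixedPoly b.coord).eval t = 0} := by
  intro Q hQ
  obtain ⟨μ, hμ⟩ := exists_frobMul_eq_smul hQ
  have := b.mem_image_fixedLine_of_frobMul_eq_smul Q.rep_nonzero (μ := μ) (fun h => ?_) hμ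
  · rwa [Q.mk_rep] at this
  · rw [h, zero_smul] at hμ
    exact b.frobMul_ne_zero h0 Q.rep_nonzero hμ

lemma fixedLine_mem_eigenlines {t : K} (ht : (fixedPoly b.coord).eval t = 0) :
    b.fixedLine t ∈ eigenlines M := by
  rw [b.fixedLine_of_isRoot ht, mk_mem_eigenlines_iff, b.frobMul_fixedVector ht, cross_self]

lemma fixedLine_injOn : Set.InjOn b.fixedLine {t | (fixedPoly b.coord).eval t = 0} := by
  intro s hs t ht h
  rw [b.fixedLine_of_isRoot hs, b.fixedLine_of_isRoot ht, Projectivization.mk_eq_mk_iff'] at h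
  obtain ⟨c, hc⟩ := h
  -- both vectors are fixed, so the scalar satisfies `c² = c`
  have h1 := congrArg (frobMul M) hc
  rw [frobMul_smul, b.frobMul_fixedVector hs, b.frobMul_fixedVector ht, ← hc] at h1
  have h2 : c ^ 2 = c := smul_left_injective K (b.fixedVector_ne_zero (ne_zero_of_isRoot ht)) h1
  have h3 : c ≠ 0 := by
    rintro rfl
    exact b.fixedVector_ne_zero (ne_zero_of_isRoot hs) (by simpa using hc.symm)
  have h4 : c = 1 := mul_left_cancel₀ h3 (by rw [mul_one, ← pow_two, h2])
  rw [h4, one_smul] at hc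
  exact (b.fixedVector_injective hc).symm

lemma encard_eigenlines [IsAlgClosed K] (h0 : b.coord 0 ≠ 0) : (eigenlines M).encard = 7 := by
  have : eigenlines M = b.fixedLine '' {t | (fixedPoly b.coord).eval t = 0} :=
    (b.eigenlines_subset_image h0).antisymm
      (Set.image_subset_iff.2 fun t ht => b.fixedLine_mem_eigenlines ht)
  classical
  rw [this, b.fixedLine_injOn.encard_image, setOf_eval_eq_zero, Set.encard_coe_eq_coe_finsetCard]
  exact_mod_cast card_roots_fixedPoly h0

/-- The kernel of `φ` is at most a line, since `φ` has a cyclic vector. -/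
lemma exists_kernel_vector [PerfectRing K 2] (h0 : b.coord 0 = 0) :
    ∃ w : Fin 3 → K, w ≠ 0 ∧ frobMul M w = 0 ∧
      ∀ x, frobMul M x = 0 → ∃ c : K, c • w = x := by
  obtain ⟨r, hr⟩ : ∃ r : K → K, ∀ a, r a ^ 2 = a :=
    ⟨(frobeniusEquiv K 2).symm, frobeniusEquiv_symm_pow_p K 2⟩
  set d : Fin 3 → K := ![r (b.coord 1), r (b.coord 2), 1] with hd
  refine ⟨d 0 • b.basis 0 + d 1 • b.basis 1 + d 2 • b.basis 2, fun h => ?_, ?_, fun x hx => ?_⟩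
  · have := b.ext_coord (c := d) (d := 0) (by simpa using h) 2
    simp [d] at this
  · have := (b.frobMul_eq_smul_iff d 0).2 (by simp [d, h0, hr, CharTwo.add_self_eq_zero])
    rwa [zero_smul] at this
  · obtain ⟨c, rfl⟩ := b.exists_coord x
    obtain ⟨-, e1, e2⟩ := (b.frobMul_eq_smul_iff c 0).1 (by rw [zero_smul, hx])
    rw [zero_mul, CharTwo.add_eq_zero] at e1 e2
    have e0 : c 0 = c 2 * d 0 := CharTwo.sq_injective (by simp [mul_pow, hd, hr, e1])
    have e1 : c 1 = c 2 * d 1 := CharTwo.sq_injective (by simp [mul_pow, hd, hr, e2])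
    refine ⟨c 2, ?_⟩
    rw [e0, e1]
    simp [d, smul_add, smul_smul]

/-- If `φ` is not injective, there are at most three eigenlines with nonzero eigenvalue, and the
kernel of `φ` is a line. -/
lemma encard_eigenlines_le_four [PerfectRing K 2] (h0 : b.coord 0 = 0) :
    (eigenlines M).encard ≤ 4 := by
  obtain ⟨w, hw, -, hker⟩ := b.exists_kernel_vector h0
  have hsub : eigenlines M ⊆ b.fixedLine '' {t | (fixedPoly b.coord).eval t = 0} ∪
      {Projectivization.mk K w hw} := by
    intro Q hQ
    obtain ⟨μ, hμ⟩ := exists_frobMul_eq_smul hQ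
    by_cases hz : μ = 0
    · right
      rw [hz, zero_smul] at hμ
      rw [Set.mem_singleton_iff, ← Q.mk_rep, Projectivization.mk_eq_mk_iff']
      exact hker _ hμ
    · left
      have := b.mem_image_fixedLine_of_frobMul_eq_smul Q.rep_nonzero hz hμ
      rwa [Q.mk_rep] at this
  refine (Set.encard_le_encard hsub).trans ((Set.encard_union_le _ _).trans ?_)
  rw [Set.encard_singleton]
  have h3 := (Set.encard_image_le b.fixedLine _).trans
    (b.encard_roots_le (natDegree_fixedPoly_le_of_eq_zero h0))
  calc _ ≤ ((3 : ℕ) : ℕ∞) + 1 := by gcongr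
    _ = 4 := by norm_num

end CyclicBasis

variable [CharP K 2] [IsAlgClosed K] {M : Matrix (Fin 3) (Fin 3) K}

lemma encard_eigenlines_le (hM : ¬ ∃ u m, M = vecMulVec u m) : (eigenlines M).encard ≤ 7 := by
  obtain ⟨x, hx⟩ := exists_cyclicDet_ne_zero hM
  obtain ⟨b⟩ := exists_cyclicBasis hx
  by_cases h0 : b.coord 0 = 0
  · exact (b.encard_eigenlines_le_four h0).trans (by norm_num)
  · exact (b.encard_eigenlines h0).le

lemma frobMul_ne_zero_of_encard_eigenlines (hM : ¬ ∃ u m, M = vecMulVec u m)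
    (h : (eigenlines M).encard = 7) {x : Fin 3 → K} (hx : x ≠ 0) : frobMul M x ≠ 0 := by
  obtain ⟨y, hy⟩ := exists_cyclicDet_ne_zero hM
  obtain ⟨b⟩ := exists_cyclicBasis hy
  refine b.frobMul_ne_zero (fun h0 => ?_) hx
  have := b.encard_eigenlines_le_four h0
  rw [h] at this
  exact absurd this (by norm_num)

lemma encard_eigenlines_of_det_ne_zero (hM : M.det ≠ 0) : (eigenlines M).encard = 7 := by
  have hM' : ¬ ∃ u m, M = vecMulVec u m := by
    rintro ⟨u, m, rfl⟩
    exact hM (det_vecMulVec u m)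
  obtain ⟨y, hy⟩ := exists_cyclicDet_ne_zero hM'
  obtain ⟨b⟩ := exists_cyclicBasis hy
  refine b.encard_eigenlines fun h0 => ?_
  -- a vector in the kernel of `φ` has its squared coordinates in the kernel of `M`
  obtain ⟨w, hw, hk, -⟩ := b.exists_kernel_vector h0
  have h1 : M *ᵥ (fun i => w i ^ 2) = 0 := by
    rw [← hk]
    rfl
  have h2 := eq_zero_of_mulVec_eq_zero hM h1
  exact hw (funext fun i => by simpa using congrFun h2 i)

end Eigenlines

/-! ### Ternary quartic forms in characteristic two -/

section NormalForm

open Matrix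

/-- The exponent of the monomial `xₚ x_q xⱼ²`, where `{i, p, q} = {0, 1, 2}`. -/
def mixedExponent (i j : Fin 3) : Fin 3 →₀ ℕ :=
  Finsupp.equivFunOnFinite.symm fun k => (if k = i then 0 else 1) + if k = j then 2 else 0

variable {K : Type*} [Field K]

/-- The matrix of the coefficients of `B` at the monomials that are not squares. The row index `i`
stands for the factor `xₚ x_q` with `{i, p, q} = {0, 1, 2}`, the column index `j` for `xⱼ²`. -/
def mixedCoeff (B : MvPolynomial (Fin 3) K) : Matrix (Fin 3) (Fin 3) K :=
  fun i j => coeff (mixedExponent i j) B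

/-- The quartic form with coefficients `c` at the `xᵢ⁴`, `d` at the `xₚ² x_q²`, and `M` at the
monomials that are not squares. -/
def quarticForm (c d : Fin 3 → K) (M : Matrix (Fin 3) (Fin 3) K) : MvPolynomial (Fin 3) K :=
  ∑ i, C (c i) * (X i ^ 2) ^ 2 + ∑ i, C (d i) * (X (i + 1) * X (i + 2)) ^ 2 +
    ∑ i, X (i + 1) * X (i + 2) * ∑ j, C (M i j) * X j ^ 2

lemma antidiagonalTuple_three_four : Finset.Nat.antidiagonalTuple 3 4 =
    {![4, 0, 0], ![0, 4, 0], ![0, 0, 4], ![0, 2, 2], ![2, 0, 2], ![2, 2, 0],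
      ![2, 1, 1], ![0, 3, 1], ![0, 1, 3], ![3, 0, 1], ![1, 2, 1], ![1, 0, 3],
      ![3, 1, 0], ![1, 3, 0], ![1, 1, 2]} := by
  decide

lemma eq_sum_antidiagonalTuple {B : MvPolynomial (Fin 3) K} (hB : B.IsHomogeneous 4) :
    B = ∑ f ∈ Finset.Nat.antidiagonalTuple 3 4,
      monomial (Finsupp.equivFunOnFinite.symm f) (coeff (Finsupp.equivFunOnFinite.symm f) B) := by
  ext m
  rw [coeff_sum]
  simp only [coeff_monomial]
  by_cases hm : m.degree = 4
  · rw [Finset.sum_eq_single (m : Fin 3 → ℕ)]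
    · have : Finsupp.equivFunOnFinite.symm (m : Fin 3 → ℕ) = m :=
        Finsupp.equivFunOnFinite.symm_apply_apply m
      rw [this, if_pos rfl]
    · intro f _ hf
      rw [if_neg]
      rintro rfl
      exact hf rfl
    · intro h
      rw [Finset.Nat.mem_antidiagonalTuple, ← Finsupp.degree_eq_sum] at h
      exact absurd hm h
  · rw [Finset.sum_eq_zero]
    · exact hB.coeff_eq_zero hm
    · intro f hf
      rw [if_neg]
      rintro rfl
      rw [Finset.Nat.mem_antidiagonalTuple] at hf
      exact hm (by rw [Finsupp.degree_eq_sum]; exact hf)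

lemma monomial_equivFunOnFinite_symm (f : Fin 3 → ℕ) (a : K) :
    monomial (Finsupp.equivFunOnFinite.symm f) a =
      C a * (X 0 ^ f 0 * X 1 ^ f 1 * X 2 ^ f 2) := by
  rw [monomial_eq, Finsupp.prod_fintype _ _ (fun i => by simp)]
  simp [Fin.prod_univ_three]

lemma mixedExponent_eq (i j : Fin 3) (f : Fin 3 → ℕ)
    (h : ∀ k, (if k = i then 0 else 1) + (if k = j then 2 else 0) = f k) :
    mixedExponent i j = Finsupp.equivFunOnFinite.symm f :=
  congrArg _ (funext h)

lemma exists_eq_quarticForm {B : MvPolynomial (Fin 3) K} (hB : B.IsHomogeneous 4) :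
    ∃ c d, B = quarticForm c d (mixedCoeff B) := by
  set e : ℕ → ℕ → ℕ → K := fun i j k => coeff (Finsupp.equivFunOnFinite.symm ![i, j, k]) B with he
  refine ⟨![e 4 0 0, e 0 4 0, e 0 0 4], ![e 0 2 2, e 2 0 2, e 2 2 0], ?_⟩
  have hM : mixedCoeff B = ![![e 2 1 1, e 0 3 1, e 0 1 3], ![e 3 0 1, e 1 2 1, e 1 0 3],
      ![e 3 1 0, e 1 3 0, e 1 1 2]] := by
    funext i j
    fin_cases i <;> fin_cases j <;> simp only [mixedCoeff] <;>
      exact congrArg (fun m => coeff m B) (mixedExponent_eq _ _ _ (by decide))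
  rw [hM]
  refine (eq_sum_antidiagonalTuple hB).trans ?_
  rw [antidiagonalTuple_three_four]
  simp only [monomial_equivFunOnFinite_symm]
  repeat rw [Finset.sum_insert (by decide)]
  rw [Finset.sum_singleton]
  simp [quarticForm, Fin.sum_univ_three, he]
  ring

variable [CharP K 2]

lemma pderiv_sq {σ : Type*} (i : σ) (p : MvPolynomial σ K) : pderiv i (p ^ 2) = 0 := by
  rw [Derivation.leibniz_pow, two_nsmul, CharTwo.add_self_eq_zero]

/-- The gradient of a quartic form in characteristic two is the cross product of the coordinate
vector and a Frobenius-semilinear function of it. -/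
lemma pderiv_quarticForm (c d : Fin 3 → K) (M : Matrix (Fin 3) (Fin 3) K) :
    (fun i => pderiv i (quarticForm c d M)) = X ⨯₃ frobMul (M.map C) X := by
  funext i
  rw [cross_apply]
  have h2 : (2 : MvPolynomial (Fin 3) K) = 0 := CharTwo.two_eq_zero
  have h3 : (3 : MvPolynomial (Fin 3) K) = 1 := by linear_combination h2
  have h4 : (4 : MvPolynomial (Fin 3) K) = 0 := by linear_combination 2 * h2
  fin_cases i <;>
  simp [quarticForm, Fin.sum_univ_three, frobMul, CharTwo.sub_eq_add] <;> ring_nf <;>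
  simp only [h2, h3, h4, mul_zero, mul_one, zero_add]

lemma pderiv_eq_cross {B : MvPolynomial (Fin 3) K} (hB : B.IsHomogeneous 4) :
    (fun i => pderiv i B) = X ⨯₃ frobMul ((mixedCoeff B).map C) X := by
  obtain ⟨c, d, h⟩ := exists_eq_quarticForm hB
  rw [← pderiv_quarticForm c d, ← h]

lemma map_cross {A A' : Type*} [CommRing A] [CommRing A'] (f : A →+* A') (x y : Fin 3 → A) :
    (fun i => f ((x ⨯₃ y) i)) = (fun i => f (x i)) ⨯₃ (fun i => f (y i)) := by
  funext i
  rw [cross_apply, cross_apply]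
  fin_cases i <;> simp

lemma map_frobMul {A A' : Type*} [CommRing A] [CommRing A'] (f : A →+* A')
    (M : Matrix (Fin 3) (Fin 3) A) (x : Fin 3 → A) :
    (fun i => f (frobMul M x i)) = frobMul (M.map f) (fun i => f (x i)) := by
  funext i
  simp [frobMul]

lemma gradAt_eq_cross {B : MvPolynomial (Fin 3) K} (hB : B.IsHomogeneous 4) (v : Fin 3 → K) :
    gradAt B v = v ⨯₃ frobMul (mixedCoeff B) v := by
  have h : ∀ i, gradAt B v i = eval v ((X ⨯₃ frobMul ((mixedCoeff B).map C) X) i) := fun i => by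
    rw [← pderiv_eq_cross hB]
    rfl
  rw [funext h, map_cross, map_frobMul]
  simp [Matrix.map_map, Function.comp_def]

lemma criticalLocus_eq_eigenlines {B : MvPolynomial (Fin 3) K} (hB : B.IsHomogeneous 4) :
    criticalLocus B = eigenlines (mixedCoeff B) := by
  ext Q
  rw [criticalLocus, eigenlines, Set.mem_ofPred_eq, Set.mem_ofPred_eq, gradAt_eq_cross hB]

end NormalForm

/-! ### The singular points of the quartic surface and its Gauss map -/

section Points

open Matrix

variable {K : Type*} [Field K]

lemma eval_quartic (B : MvPolynomial (Fin 3) K) (v : Fin 4 → K) :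
    eval v (quartic B) = v 3 ^ 4 + v 3 ^ 2 * v 0 ^ 2 + eval (fun i => v (Fin.castSucc i)) B := by
  simp [quartic, eval_rename, Function.comp_def]

lemma eval_smul_quartic {B : MvPolynomial (Fin 3) K} (hB : B.IsHomogeneous 4) (a : K)
    (x : Fin 3 → K) : eval (fun i => a * x i) B = a ^ 4 * eval x B := by
  obtain ⟨c, d, h⟩ := exists_eq_quarticForm hB
  rw [h]
  simp [quarticForm, Fin.sum_univ_three]
  ring

lemma pderiv_castSucc_quartic [CharP K 2] (B : MvPolynomial (Fin 3) K) (i : Fin 3) :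
    pderiv i.castSucc (quartic B) = rename Fin.castSucc (pderiv i B) := by
  rw [← pderiv_rename (Fin.castSucc_injective 3)]
  have h : (X 3 ^ 4 + X 3 ^ 2 * X 0 ^ 2 : MvPolynomial (Fin 4) K) = (X 3 ^ 2 + X 3 * X 0) ^ 2 := by
    rw [CharTwo.add_sq]
    ring
  rw [quartic, h, map_add, pderiv_sq, zero_add]

lemma pderiv_three_quartic [CharP K 2] (B : MvPolynomial (Fin 3) K) : pderiv 3 (quartic B) = 0 := by
  classical
  have h : (X 3 ^ 4 + X 3 ^ 2 * X 0 ^ 2 : MvPolynomial (Fin 4) K) = (X 3 ^ 2 + X 3 * X 0) ^ 2 := by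
    rw [CharTwo.add_sq]
    ring
  rw [quartic, h, map_add, pderiv_sq, zero_add]
  refine pderiv_eq_zero_of_notMem_vars fun hm => ?_
  obtain ⟨i, -, hi⟩ := Finset.mem_image.1 (vars_rename _ _ hm)
  exact absurd hi (Fin.castSucc_lt_last i).ne

lemma gradAt_quartic [CharP K 2] (B : MvPolynomial (Fin 3) K) (v : Fin 4 → K) :
    gradAt (quartic B) v = Fin.snoc (α := fun _ => K) (gradAt B fun i => v i.castSucc) 0 := by
  funext i
  refine Fin.lastCases ?_ (fun i => ?_) i
  · rw [Fin.snoc_last]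
    exact (congrArg (eval v) (pderiv_three_quartic B)).trans (map_zero _)
  · rw [Fin.snoc_castSucc, gradAt, gradAt, pderiv_castSucc_quartic, eval_rename]
    rfl

lemma gradAt_smul [CharP K 2] {B : MvPolynomial (Fin 3) K} (hB : B.IsHomogeneous 4) (c : K)
    (v : Fin 3 → K) :
    gradAt B (c • v) = c ^ 3 • gradAt B v := by
  rw [gradAt_eq_cross hB, gradAt_eq_cross hB, frobMul_smul, map_smul, map_smul,
    LinearMap.smul_apply, smul_smul]
  congr 1
  ring

lemma mk_mem_criticalLocus_iff [CharP K 2] {B : MvPolynomial (Fin 3) K} (hB : B.IsHomogeneous 4)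
    {x : Fin 3 → K} (hx : x ≠ 0) :
    Projectivization.mk K x hx ∈ criticalLocus B ↔ gradAt B x = 0 := by
  rw [criticalLocus_eq_eigenlines hB, mk_mem_eigenlines_iff, gradAt_eq_cross hB]

lemma mem_criticalLocus_quartic_iff [CharP K 2] {B : MvPolynomial (Fin 3) K} {P : ℙ K (Fin 4 → K)} :
    P ∈ criticalLocus (quartic B) ↔ gradAt B (xPart P) = 0 := by
  rw [criticalLocus, Set.mem_ofPred_eq, gradAt_quartic]
  constructor
  · intro h
    funext i
    have := congrFun h i.castSucc
    rwa [Fin.snoc_castSucc] at this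
  · intro h
    change Fin.snoc (α := fun _ => K) (gradAt B (xPart P)) 0 = 0
    rw [h]
    funext i
    refine Fin.lastCases ?_ (fun i => ?_) i
    · rw [Fin.snoc_last, Pi.zero_apply]
    · rw [Fin.snoc_castSucc, Pi.zero_apply, Pi.zero_apply]

lemma xPart_ne_zero {B : MvPolynomial (Fin 3) K} (hB : B.IsHomogeneous 4) {P : ℙ K (Fin 4 → K)}
    (hP : P ∈ zeroLocus (quartic B)) : xPart P ≠ 0 := by
  intro h
  rw [zeroLocus, Set.mem_ofPred_eq, eval_quartic] at hP
  have h0 : P.rep 0 = 0 := congrFun h 0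
  have hB0 : eval (xPart P) B = 0 := by
    rw [h]
    simpa using eval_smul_quartic hB 0 0
  have h3 : P.rep 3 = 0 := by
    change _ + eval (xPart P) B = 0 at hP
    rw [hB0, h0] at hP
    simpa using hP
  refine P.rep_nonzero (funext fun i => ?_)
  exact Fin.lastCases h3 (fun i => congrFun h i) i

lemma mem_singularLocus_iff [CharP K 2] {B : MvPolynomial (Fin 3) K} (hB : B.IsHomogeneous 4)
    (P : ℙ K (Fin 4 → K)) : P ∈ singularLocus (quartic B) ↔
      P ∈ zeroLocus (quartic B) ∧ ∃ hP : xPart P ≠ 0, proj P hP ∈ criticalLocus B := by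
  refine and_congr_right fun hP => ?_
  rw [mem_criticalLocus_quartic_iff]
  exact ⟨fun h => ⟨xPart_ne_zero hB hP, (mk_mem_criticalLocus_iff hB _).2 h⟩,
    fun ⟨_, h⟩ => (mk_mem_criticalLocus_iff hB _).1 h⟩

/-- The Gauss map factors pointwise through the projection and the gradient map of `B`. -/
lemma gaussMap_quartic [CharP K 2] {B : MvPolynomial (Fin 3) K} (hB : B.IsHomogeneous 4)
    (P : {P : ℙ K (Fin 4 → K) // P ∈ zeroLocus (quartic B) ∧ P ∉ singularLocus (quartic B)}) :
    ∃ (hx : xPart P.1 ≠ 0) (hc : proj P.1 hx ∉ criticalLocus B),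
      gaussMap (quartic B) P = planeInclusion (gradientMap B (proj P.1 hx) hc) := by
  have hx := xPart_ne_zero hB P.2.1
  have hc : proj P.1 hx ∉ criticalLocus B := fun h =>
    P.2.2 ((mem_singularLocus_iff hB P.1).2 ⟨P.2.1, hx, h⟩)
  refine ⟨hx, hc, ?_⟩
  obtain ⟨a, ha⟩ := Projectivization.exists_smul_eq_mk_rep K (xPart P.1) hx
  obtain ⟨b, hb⟩ := Projectivization.exists_smul_eq_mk_rep K (gradAt B (proj P.1 hx).rep) hc
  refine (Projectivization.mk_eq_mk_iff' K _ _ _ _).2 ?_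
  refine ⟨((b : K) * (a : K) ^ 3)⁻¹, ?_⟩
  have hne : (b : K) * (a : K) ^ 3 ≠ 0 := mul_ne_zero b.ne_zero (pow_ne_zero _ a.ne_zero)
  rw [inv_smul_eq_iff₀ hne, gradAt_quartic]
  have h1 : (gradientMap B (proj P.1 hx) hc).rep = ((b : K) * (a : K) ^ 3) •
      gradAt B (xPart P.1) := by
    have : (proj P.1 hx).rep = (a : K) • xPart P.1 := ha.symm
    rw [gradientMap, ← hb, this, gradAt_smul hB, Units.smul_def, smul_smul]
  rw [h1]
  funext i
  refine Fin.lastCases ?_ (fun i => ?_) i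
  · rw [Fin.snoc_last, Pi.smul_apply, Fin.snoc_last, smul_zero]
  · rw [Fin.snoc_castSucc, Pi.smul_apply, Pi.smul_apply, Fin.snoc_castSucc]
    rfl

lemma exists_height [IsAlgClosed K] (B : MvPolynomial (Fin 3) K) (x : Fin 3 → K) :
    ∃ r : K, r ^ 4 + r ^ 2 * x 0 ^ 2 + eval x B = 0 := by
  have hd : (Polynomial.X ^ 4 + Polynomial.C (x 0 ^ 2) * Polynomial.X ^ 2 +
      Polynomial.C (eval x B)).degree ≠ 0 := by
    have : (Polynomial.X ^ 4 + Polynomial.C (x 0 ^ 2) * Polynomial.X ^ 2 +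
      Polynomial.C (eval x B)).degree = 4 := by compute_degree!
    rw [this]
    decide
  obtain ⟨r, hr⟩ := IsAlgClosed.exists_root _ hd
  refine ⟨r, ?_⟩
  simp only [Polynomial.IsRoot, Polynomial.eval_add, Polynomial.eval_pow, Polynomial.eval_X,
    Polynomial.eval_mul, Polynomial.eval_C] at hr
  linear_combination hr

/-- The last coordinate of a chosen point of the surface over a point of the plane. -/
def height [IsAlgClosed K] (B : MvPolynomial (Fin 3) K) (Q : ℙ K (Fin 3 → K)) : K :=
  (exists_height B Q.rep).choose

lemma height_spec [IsAlgClosed K] (B : MvPolynomial (Fin 3) K) (Q : ℙ K (Fin 3 → K)) :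
    height B Q ^ 4 + height B Q ^ 2 * Q.rep 0 ^ 2 + eval Q.rep B = 0 :=
  (exists_height B Q.rep).choose_spec

lemma snoc_ne_zero {x : Fin 3 → K} (hx : x ≠ 0) (r : K) :
    (Fin.snoc x r : Fin 4 → K) ≠ 0 := fun h => hx <| funext fun i => by
  have := congrFun h i.castSucc
  rwa [Fin.snoc_castSucc] at this

/-- The point over `Q` with last coordinate `r`, relative to the representative of `Q`. -/
def lift (Q : ℙ K (Fin 3 → K)) (r : K) : ℙ K (Fin 4 → K) :=
  Projectivization.mk K (Fin.snoc Q.rep r) (snoc_ne_zero Q.rep_nonzero r)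

lemma lift_inj {Q Q' : ℙ K (Fin 3 → K)} {r r' : K} (h : lift Q r = lift Q' r') :
    Q = Q' ∧ r = r' := by
  rw [lift, lift, Projectivization.mk_eq_mk_iff'] at h
  obtain ⟨a, ha⟩ := h
  have h1 : a • Q'.rep = Q.rep := funext fun i => by
    have := congrFun ha i.castSucc
    rwa [Pi.smul_apply, Fin.snoc_castSucc, Fin.snoc_castSucc] at this
  have hQ : Q = Q' := by
    rw [← Q.mk_rep, ← Q'.mk_rep, Projectivization.mk_eq_mk_iff']
    exact ⟨a, h1⟩
  subst hQ
  have ha1 : a = 1 := smul_left_injective K Q.rep_nonzero (by simpa using h1)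
  have := congrFun ha (Fin.last 3)
  rw [Pi.smul_apply, Fin.snoc_last, Fin.snoc_last, ha1, one_smul] at this
  exact ⟨rfl, this.symm⟩

lemma lift_proj (P : ℙ K (Fin 4 → K)) (hP : xPart P ≠ 0) :
    ∃ r, P = lift (proj P hP) r := by
  obtain ⟨a, ha⟩ := Projectivization.exists_smul_eq_mk_rep K (xPart P) hP
  refine ⟨a * P.rep 3, ?_⟩
  refine P.mk_rep.symm.trans ((Projectivization.mk_eq_mk_iff K _ _ _ _).2 ?_)
  refine ⟨a⁻¹, inv_smul_eq_iff.2 (funext fun i => ?_)⟩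
  refine Fin.lastCases ?_ (fun i => ?_) i
  · rw [Fin.snoc_last]
    rfl
  · rw [Fin.snoc_castSucc]
    exact (congrFun ha i).symm

lemma lift_mem_zeroLocus_iff {B : MvPolynomial (Fin 3) K} (hB : B.IsHomogeneous 4)
    (Q : ℙ K (Fin 3 → K)) (r : K) : lift Q r ∈ zeroLocus (quartic B) ↔
      r ^ 4 + r ^ 2 * Q.rep 0 ^ 2 + eval Q.rep B = 0 := by
  obtain ⟨a, ha⟩ := Projectivization.exists_smul_eq_mk_rep K (Fin.snoc Q.rep r : Fin 4 → K)
    (snoc_ne_zero Q.rep_nonzero r)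
  have h3 : (lift Q r).rep 3 = a * r := by
    have := (congrFun ha (Fin.last 3)).symm
    rwa [Pi.smul_apply, Fin.snoc_last] at this
  have hi : ∀ i : Fin 3, (lift Q r).rep i.castSucc = a * Q.rep i := fun i => by
    have := (congrFun ha i.castSucc).symm
    rwa [Pi.smul_apply, Fin.snoc_castSucc] at this
  rw [zeroLocus, Set.mem_ofPred_eq, eval_quartic, h3, funext hi, eval_smul_quartic hB]
  have h0 : (lift Q r).rep 0 = a * Q.rep 0 := hi 0
  rw [h0, show ((a : K) * r) ^ 4 + (a * r) ^ 2 * (a * Q.rep 0) ^ 2 + a ^ 4 * eval Q.rep B =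
    (a : K) ^ 4 * (r ^ 4 + r ^ 2 * Q.rep 0 ^ 2 + eval Q.rep B) by ring]
  simp

/-- The fibre of the surface over a point of the plane: in characteristic two the equation of the
fibre is the square of a quadratic equation with roots `r` and `r + x₁`. -/
lemma lift_mem_zeroLocus_iff_eq [CharP K 2] [IsAlgClosed K] {B : MvPolynomial (Fin 3) K}
    (hB : B.IsHomogeneous 4)
    (Q : ℙ K (Fin 3 → K)) (r : K) : lift Q r ∈ zeroLocus (quartic B) ↔
      r = height B Q ∨ r = height B Q + Q.rep 0 := by
  have h2 : (2 : K) = 0 := CharTwo.two_eq_zero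
  have hs := height_spec B Q
  rw [lift_mem_zeroLocus_iff hB]
  set s := height B Q
  have key : r ^ 4 + r ^ 2 * Q.rep 0 ^ 2 + eval Q.rep B =
      ((r - s) * (r - (s + Q.rep 0))) ^ 2 := by
    simp only [CharTwo.sub_eq_add]
    rw [show (r + s) * (r + (s + Q.rep 0)) = (r * r + s * s) + (r + s) * Q.rep 0 by
      linear_combination r * s * h2]
    simp only [CharTwo.add_sq, mul_pow]
    linear_combination hs - (s ^ 4 + s ^ 2 * Q.rep 0 ^ 2) * h2
  rw [key]
  simp [sub_eq_zero]

lemma proj_lift (Q : ℙ K (Fin 3 → K)) (r : K) (h : xPart (lift Q r) ≠ 0) :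
    proj (lift Q r) h = Q := by
  obtain ⟨s, hs⟩ := lift_proj (lift Q r) h
  exact (lift_inj hs).1.symm

lemma lift_mem_singularLocus_iff [CharP K 2] [IsAlgClosed K] {B : MvPolynomial (Fin 3) K}
    (hB : B.IsHomogeneous 4)
    (Q : ℙ K (Fin 3 → K)) (r : K) : lift Q r ∈ singularLocus (quartic B) ↔
      (r = height B Q ∨ r = height B Q + Q.rep 0) ∧ Q ∈ criticalLocus B := by
  rw [mem_singularLocus_iff hB, lift_mem_zeroLocus_iff_eq hB]
  refine and_congr_right fun hr => ⟨fun ⟨h, hc⟩ => ?_, fun h => ?_⟩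
  · rwa [proj_lift] at hc
  · refine ⟨xPart_ne_zero hB ((lift_mem_zeroLocus_iff_eq hB Q r).2 hr), ?_⟩
    rwa [proj_lift]

lemma singularLocus_eq [CharP K 2] [IsAlgClosed K] {B : MvPolynomial (Fin 3) K}
    (hB : B.IsHomogeneous 4) :
    singularLocus (quartic B) = (fun Q => lift Q (height B Q)) '' criticalLocus B ∪
      (fun Q => lift Q (height B Q + Q.rep 0)) '' {Q ∈ criticalLocus B | Q.rep 0 ≠ 0} := by
  ext P
  constructor
  · intro h
    obtain ⟨hz, hP, -⟩ := (mem_singularLocus_iff hB P).1 h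
    obtain ⟨r, hr⟩ := lift_proj P hP
    rw [hr, lift_mem_singularLocus_iff hB] at h
    obtain ⟨h1, hc⟩ := h
    rw [hr]
    by_cases h0 : (proj P hP).rep 0 = 0
    · left
      rw [h0, add_zero, or_self] at h1
      exact ⟨_, hc, by rw [h1]⟩
    · rcases h1 with h1 | h1
      · exact Or.inl ⟨_, hc, by rw [h1]⟩
      · exact Or.inr ⟨_, ⟨hc, h0⟩, by rw [h1]⟩
  · rintro (⟨Q, hQ, rfl⟩ | ⟨Q, ⟨hQ, -⟩, rfl⟩)
    · exact (lift_mem_singularLocus_iff hB _ _).2 ⟨Or.inl rfl, hQ⟩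
    · exact (lift_mem_singularLocus_iff hB _ _).2 ⟨Or.inr rfl, hQ⟩

/-- Each critical point of `B` carries two singular points of the surface, or one if it lies on
the line `x₁ = 0`. -/
lemma encard_singularLocus [CharP K 2] [IsAlgClosed K] {B : MvPolynomial (Fin 3) K}
    (hB : B.IsHomogeneous 4) :
    (singularLocus (quartic B)).encard =
      (criticalLocus B).encard + {Q ∈ criticalLocus B | Q.rep 0 ≠ 0}.encard := by
  rw [singularLocus_eq hB, Set.encard_union_eq, Function.Injective.encard_image,
    Function.Injective.encard_image]
  · exact fun Q Q' h => (lift_inj h).1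
  · exact fun Q Q' h => (lift_inj h).1
  · rw [Set.disjoint_left]
    rintro _ ⟨Q, -, rfl⟩ ⟨Q', ⟨-, h0⟩, h⟩
    obtain ⟨rfl, h1⟩ := lift_inj h
    exact h0 (by simpa using h1)

end Points

/-! ### Nodes -/

section Nodes

open Matrix

variable {K : Type*} [Field K]

lemma isHomogeneous_C_mul_X_pow_mul_X_pow {σ : Type*} (k : K) (i j : σ) (a b : ℕ) :
    (C k * (X i ^ a * X j ^ b) : MvPolynomial σ K).IsHomogeneous (a + b) :=
  ((isHomogeneous_X_pow i a).mul (isHomogeneous_X_pow j b)).C_mul k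

lemma homogeneousComponent_of_eq_sum {σ : Type*} {f f₀ f₁ f₂ f₃ f₄ : MvPolynomial σ K}
    (h₀ : f₀.IsHomogeneous 0) (h₁ : f₁.IsHomogeneous 1) (h₂ : f₂.IsHomogeneous 2)
    (h₃ : f₃.IsHomogeneous 3) (h₄ : f₄.IsHomogeneous 4) (h : f = f₀ + f₁ + f₂ + f₃ + f₄) :
    homogeneousComponent 0 f = f₀ ∧ homogeneousComponent 1 f = f₁ ∧
      homogeneousComponent 2 f = f₂ := by
  subst h
  simp only [map_add, homogeneousComponent_of_mem ((mem_homogeneousSubmodule _ _).2 h₀),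
    homogeneousComponent_of_mem ((mem_homogeneousSubmodule _ _).2 h₁),
    homogeneousComponent_of_mem ((mem_homogeneousSubmodule _ _).2 h₂),
    homogeneousComponent_of_mem ((mem_homogeneousSubmodule _ _).2 h₃),
    homogeneousComponent_of_mem ((mem_homogeneousSubmodule _ _).2 h₄)]
  norm_num

/-- The Taylor expansion of the affine equation `F(1, y₁, y₂, z)`, up to second order. -/
lemma homogeneousComponent_translate [CharP K 2] (c d : Fin 3 → K) (M : Matrix (Fin 3) (Fin 3) K)
    (a : {j : Fin 4 // j ≠ 0} → K) (x : Fin 3 → K)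
    (hx : x = ![1, a ⟨1, by decide⟩, a ⟨2, by decide⟩]) (ζ : K) (hζ : ζ = a ⟨3, by decide⟩) :
    let f := translate a (chartEquation (quartic (quarticForm c d M)) 0)
    homogeneousComponent 0 f = C (ζ ^ 4 + ζ ^ 2 + eval x (quarticForm c d M)) ∧
    homogeneousComponent 1 f =
      C (x 2 * frobMul M x 0 + frobMul M x 2) * X ⟨1, by decide⟩ +
        C (x 1 * frobMul M x 0 + frobMul M x 1) * X ⟨2, by decide⟩ ∧
    ∃ α β : K, homogeneousComponent 2 f = X ⟨3, by decide⟩ ^ 2 + C α * X ⟨1, by decide⟩ ^ 2 +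
      C β * X ⟨2, by decide⟩ ^ 2 + C (frobMul M x 0) * (X ⟨1, by decide⟩ * X ⟨2, by decide⟩) := by
  intro f
  set Y₁ : {j : Fin 4 // j ≠ 0} := ⟨1, by decide⟩
  set Y₂ : {j : Fin 4 // j ≠ 0} := ⟨2, by decide⟩
  set Z : {j : Fin 4 // j ≠ 0} := ⟨3, by decide⟩
  have hm := isHomogeneous_C_mul_X_pow_mul_X_pow (K := K) (σ := {j : Fin 4 // j ≠ 0})
  obtain ⟨h0, h1, h2⟩ := homogeneousComponent_of_eq_sum (f := f)
    (f₀ := C (ζ ^ 4 + ζ ^ 2 + eval x (quarticForm c d M)))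
    (f₁ := C (x 2 * frobMul M x 0 + frobMul M x 2) * X Y₁ +
        C (x 1 * frobMul M x 0 + frobMul M x 1) * X Y₂)
    (f₂ := X Z ^ 2 + C (d 0 * x 2 ^ 2 + d 2 + x 1 * x 2 * M 0 1 + x 2 * M 1 1 + x 1 * M 2 1) *
      X Y₁ ^ 2 + C (d 0 * x 1 ^ 2 + d 1 + x 1 * x 2 * M 0 2 + x 2 * M 1 2 + x 1 * M 2 2) *
      X Y₂ ^ 2 + C (frobMul M x 0) * (X Y₁ * X Y₂))
    (f₃ := C (x 2 * M 0 1 + M 2 1) * (X Y₁ ^ 3 * X Y₂ ^ 0) +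
      C (x 2 * M 0 2 + M 2 2) * (X Y₁ ^ 1 * X Y₂ ^ 2) +
      C (x 1 * M 0 1 + M 1 1) * (X Y₁ ^ 2 * X Y₂ ^ 1) +
      C (x 1 * M 0 2 + M 1 2) * (X Y₁ ^ 0 * X Y₂ ^ 3))
    (f₄ := X Z ^ 4 + C (c 1) * (X Y₁ ^ 4 * X Y₂ ^ 0) + C (c 2) * (X Y₁ ^ 0 * X Y₂ ^ 4) +
      C (d 0) * (X Y₁ ^ 2 * X Y₂ ^ 2) + C (M 0 1) * (X Y₁ ^ 3 * X Y₂ ^ 1) +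
      C (M 0 2) * (X Y₁ ^ 1 * X Y₂ ^ 3))
    (isHomogeneous_C _ _)
    (((isHomogeneous_X K Y₁).C_mul _).add ((isHomogeneous_X K Y₂).C_mul _))
    ((((isHomogeneous_X_pow Z 2).add ((isHomogeneous_X_pow Y₁ 2).C_mul _)).add
      ((isHomogeneous_X_pow Y₂ 2).C_mul _)).add
        (((isHomogeneous_X K Y₁).mul (isHomogeneous_X K Y₂)).C_mul _))
    ((((hm _ Y₁ Y₂ 3 0).add (hm _ Y₁ Y₂ 1 2)).add (hm _ Y₁ Y₂ 2 1)).add (hm _ Y₁ Y₂ 0 3))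
    ((((((isHomogeneous_X_pow Z 4).add (hm _ Y₁ Y₂ 4 0)).add (hm _ Y₁ Y₂ 0 4)).add
      (hm _ Y₁ Y₂ 2 2)).add (hm _ Y₁ Y₂ 3 1)).add (hm _ Y₁ Y₂ 1 3)) (by
    have hX0 : ∀ j : {j : Fin 4 // j ≠ 0}, (X j + C (a j) : MvPolynomial _ K) ^ 4 =
        X j ^ 4 + C (a j) ^ 4 := fun j => by
      have h4 : ∀ p : MvPolynomial {j : Fin 4 // j ≠ 0} K, p ^ 4 = (p ^ 2) ^ 2 := fun p => by ring
      rw [h4, CharTwo.add_sq, CharTwo.add_sq, ← h4, ← h4]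
    have e1 : a Y₁ = x 1 := by rw [hx]; rfl
    have e2 : a Y₂ = x 2 := by rw [hx]; rfl
    have e3 : a Z = ζ := hζ.symm
    have e0 : x 0 = 1 := by rw [hx]; rfl
    have hf : f = (X Z + C ζ) ^ 4 + (X Z + C ζ) ^ 2 +
        (C (c 0) + C (c 1) * (X Y₁ + C (x 1)) ^ 4 + C (c 2) * (X Y₂ + C (x 2)) ^ 4 +
        C (d 0) * ((X Y₁ + C (x 1)) ^ 2 * (X Y₂ + C (x 2)) ^ 2) +
        C (d 1) * (X Y₂ + C (x 2)) ^ 2 + C (d 2) * (X Y₁ + C (x 1)) ^ 2 +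
        (X Y₁ + C (x 1)) * (X Y₂ + C (x 2)) * (C (M 0 0) + C (M 0 1) * (X Y₁ + C (x 1)) ^ 2 +
          C (M 0 2) * (X Y₂ + C (x 2)) ^ 2) +
        (X Y₂ + C (x 2)) * (C (M 1 0) + C (M 1 1) * (X Y₁ + C (x 1)) ^ 2 +
          C (M 1 2) * (X Y₂ + C (x 2)) ^ 2) +
        (X Y₁ + C (x 1)) * (C (M 2 0) + C (M 2 1) * (X Y₁ + C (x 1)) ^ 2 +
          C (M 2 2) * (X Y₂ + C (x 2)) ^ 2)) := by
      simp only [f, translate, chartEquation, quartic, quarticForm]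
      simp [Fin.sum_univ_three, Y₁, Y₂, Z, ← e1, ← e2, ← e3]
      ring
    rw [hf]
    simp only [← e1, ← e2, ← e3, hX0, CharTwo.add_sq]
    simp only [e1, e2, e3]
    simp [quarticForm, Fin.sum_univ_three, frobMul, e0]
    ring)
  exact ⟨h0, h1, _, _, h2⟩

/-- A quadratic form `z² + α y₁² + β y₂² + γ y₁ y₂` with `γ ≠ 0` defines a smooth conic in
characteristic two. -/
lemma isSmoothQuadric [CharP K 2] {α β γ : K} (hγ : γ ≠ 0) :
    IsSmoothQuadric (X ⟨3, by decide⟩ ^ 2 + C α * X ⟨1, by decide⟩ ^ 2 +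
      C β * X ⟨2, by decide⟩ ^ 2 + C γ * (X ⟨1, by decide⟩ * X ⟨2, by decide⟩) :
        MvPolynomial {j : Fin 4 // j ≠ 0} K) := by
  rintro v hv ⟨h, hd⟩
  have h1 := hd ⟨1, by decide⟩
  have h2 := hd ⟨2, by decide⟩
  simp only [map_add, pderiv_sq, pderiv_C_mul] at h1 h2
  simp [pderiv_X, hγ] at h1 h2
  simp [h1, h2] at h
  refine hv (funext fun j => ?_)
  obtain ⟨j, hj⟩ := j
  fin_cases j
  · exact absurd rfl hj
  · exact h2
  · exact h1
  · exact h

/-- A singular point of the surface outside `x₁ = 0` is a node, unless the semilinear map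
attached to `B` vanishes at it. -/
lemma isNode_of_frobMul_ne_zero [CharP K 2] {B : MvPolynomial (Fin 3) K}
    (hB : B.IsHomogeneous 4) {P : ℙ K (Fin 4 → K)} (hP : P ∈ singularLocus (quartic B))
    (h0 : P.rep 0 ≠ 0) (hφ : frobMul (mixedCoeff B) (xPart P) ≠ 0) : IsNode (quartic B) P := by
  obtain ⟨c, d, hcd⟩ := exists_eq_quarticForm hB
  set M := mixedCoeff B
  obtain ⟨hz, hc⟩ := hP
  set x : Fin 3 → K := (P.rep 0)⁻¹ • xPart P with hx
  have hxP : xPart P = P.rep 0 • x := by rw [hx, smul_inv_smul₀ h0]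
  have hx0 : x 0 = 1 := inv_mul_cancel₀ h0
  rw [mem_criticalLocus_quartic_iff, hxP, gradAt_smul hB, smul_eq_zero,
    or_iff_right (pow_ne_zero 3 h0), gradAt_eq_cross hB] at hc
  obtain ⟨μ, hμ⟩ := exists_eq_smul_of_cross_eq_zero (fun h => by simp [h] at hx0) hc
  have hμ0 : frobMul M x 0 = μ := by rw [hμ, Pi.smul_apply, hx0, smul_eq_mul, mul_one]
  have hγ : frobMul M x 0 ≠ 0 := by
    rintro h
    rw [hμ0] at h
    rw [hxP, frobMul_smul, hμ, h, zero_smul, smul_zero] at hφ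
    exact hφ rfl
  have hxv : x = ![1, P.rep 1 / P.rep 0, P.rep 2 / P.rep 0] := by
    funext i
    fin_cases i
    · exact hx0
    · exact inv_mul_eq_div _ _
    · exact inv_mul_eq_div _ _
  obtain ⟨e0, e1, α, β, e2⟩ := homogeneousComponent_translate c d M
    (fun j : {j : Fin 4 // j ≠ 0} => P.rep j / P.rep 0) x hxv (P.rep 3 / P.rep 0) rfl
  rw [← hcd] at e0 e1 e2
  refine ⟨0, h0, ?_, ?_, ?_⟩
  · rw [e0]
    rw [zeroLocus, Set.mem_ofPred_eq, eval_quartic] at hz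
    change _ + eval (xPart P) B = 0 at hz
    have : eval (xPart P) B = P.rep 0 ^ 4 * eval x B := by
      rw [hxP]
      exact eval_smul_quartic hB _ _
    rw [this] at hz
    rw [← map_zero C]
    congr 1
    field_simp
    linear_combination hz
  · rw [e1, hμ]
    simp only [Pi.smul_apply, smul_eq_mul, hx0, mul_comm μ, one_mul, CharTwo.add_self_eq_zero,
      map_zero, zero_mul]
  · rw [e2]
    exact isSmoothQuadric hγ

end Nodes

/-! ### Normality -/

section Normality

open Matrix

variable {K : Type*} [Field K]

/-- In a ring with an integrally closed local ring at `p`, if `g² = l² q`, then `g / l` is regular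
at `p`. -/
lemma exists_mul_eq_mul_of_sq_eq {A : Type*} [CommRing A] (p : Ideal A) [p.IsPrime]
    [IsDomain (Localization.AtPrime p)] [IsIntegrallyClosed (Localization.AtPrime p)]
    {g l q : A} (h : g ^ 2 = l ^ 2 * q) : ∃ s ∉ p, ∃ r, s * g = l * r := by
  have hdvd : algebraMap A (Localization.AtPrime p) l ^ 2 ∣
      algebraMap A (Localization.AtPrime p) g ^ 2 :=
    ⟨algebraMap A _ q, by rw [← map_pow, ← map_pow, ← map_mul, h]⟩
  obtain ⟨c, hc⟩ := (IsIntegrallyClosed.pow_dvd_pow_iff two_ne_zero).1 hdvd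
  obtain ⟨r, s, rfl⟩ := IsLocalization.exists_mk'_eq p.primeCompl c
  have hc' : algebraMap A (Localization.AtPrime p) (g * s) = algebraMap A _ (l * r) := by
    rw [map_mul, map_mul, hc, mul_assoc, IsLocalization.mk'_spec]
  obtain ⟨u, hu⟩ := (IsLocalization.eq_iff_exists p.primeCompl _).1 hc'
  exact ⟨u * s, (u * s).2, u * r, by linear_combination hu⟩

/-- If `F = G² - l² q`, then `G / l` is integral over the coordinate ring of the hypersurface
`F = 0`. The hypersurface is not normal if this fraction is not a regular function, which is
tested on a curve `γ` in the `i`-th chart, contained in `l = 0` but not in `G = 0`, at a point of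
`G = 0`. -/
lemma not_isNormal_of_eq_sq_sub {n : ℕ} {F G l q : MvPolynomial (Fin n) K}
    (hF : F = G ^ 2 - l ^ 2 * q) (i : Fin n) (γ : Fin n → Polynomial K) (hγ : γ i = 1)
    (hl : aeval γ l = 0) (hG : aeval γ G ≠ 0) {t : K} (ht : (aeval γ G).eval t = 0) :
    ¬ IsNormal F := by
  intro hn
  let dh : MvPolynomial (Fin n) K →ₐ[K] MvPolynomial {j : Fin n // j ≠ i} K :=
    aeval (fun j => if h : j = i then 1 else X ⟨j, h⟩)
  have hdhF : chartEquation F i = dh G ^ 2 - dh l ^ 2 * dh q := by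
    rw [← map_pow, ← map_pow, ← map_mul, ← map_sub, ← hF]
    rfl
  let ψ : MvPolynomial {j : Fin n // j ≠ i} K →ₐ[K] Polynomial K := aeval fun j => γ j
  have hψ : ∀ p, ψ (dh p) = aeval γ p := by
    intro p
    rw [← AlgHom.comp_apply]
    congr 1
    refine algHom_ext fun j => ?_
    by_cases h : j = i
    · subst h
      simp [dh, hγ]
    · rw [AlgHom.comp_apply, aeval_X, aeval_X, dif_neg h, aeval_X]
  have hψF : ψ (chartEquation F i) = aeval γ G ^ 2 := by
    rw [hdhF, map_sub, map_mul, map_pow, map_pow, hψ, hψ, hl]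
    ring
  let ev : MvPolynomial {j : Fin n // j ≠ i} K →+* K := (Polynomial.evalRingHom t).comp ψ.toRingHom
  have hev : ∀ p, ev p = (ψ p).eval t := fun p => rfl
  have hevF : ∀ a ∈ Ideal.span {chartEquation F i}, ev a = 0 := by
    intro a ha
    obtain ⟨b, rfl⟩ := Ideal.mem_span_singleton.1 ha
    rw [map_mul, hev, hψF, Polynomial.eval_pow, ht]
    ring
  let ev' : ChartRing F i →+* K := Ideal.Quotient.lift _ ev hevF
  have hp : (RingHom.ker ev').IsPrime := RingHom.ker_isPrime ev'
  obtain ⟨h1, h2⟩ := hn i (RingHom.ker ev')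
  have hsq : (Ideal.Quotient.mk _ (dh G) : ChartRing F i) ^ 2 =
      Ideal.Quotient.mk _ (dh l) ^ 2 * Ideal.Quotient.mk _ (dh q) := by
    have hmem : dh G ^ 2 - dh l ^ 2 * dh q ∈ Ideal.span {chartEquation F i} := by
      rw [← hdhF]
      exact Ideal.mem_span_singleton_self _
    have := Ideal.Quotient.eq.2 hmem
    rwa [map_mul, map_pow, map_pow] at this
  obtain ⟨s, hs, r, hsr⟩ := exists_mul_eq_mul_of_sq_eq (RingHom.ker ev') hsq
  obtain ⟨r, rfl⟩ := Ideal.Quotient.mk_surjective r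
  obtain ⟨s, rfl⟩ := Ideal.Quotient.mk_surjective s
  rw [← map_mul, ← map_mul, Ideal.Quotient.eq] at hsr
  obtain ⟨w, hw⟩ := Ideal.mem_span_singleton.1 hsr
  have hw' := congrArg ψ hw
  simp only [map_sub, map_mul, hψ, hl, hψF] at hw'
  have key : ψ s = aeval γ G * ψ w := mul_left_cancel₀ hG (by linear_combination hw')
  refine hs ?_
  rw [RingHom.mem_ker, Ideal.Quotient.lift_mk, hev, key, Polynomial.eval_mul, ht, zero_mul]

variable [CharP K 2] [IsAlgClosed K]

lemma exists_ne_zero_sum_mul_sq_eq_zero (m : Fin 3 → K) :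
    ∃ x : Fin 3 → K, x ≠ 0 ∧ ∑ j, m j * x j ^ 2 = 0 := by
  obtain ⟨r, hr⟩ : ∃ r : K → K, ∀ a, r a ^ 2 = a :=
    ⟨(frobeniusEquiv K 2).symm, frobeniusEquiv_symm_pow_p K 2⟩
  by_cases h : m 0 = 0
  · exact ⟨![1, 0, 0], fun e => one_ne_zero (congrFun e 0), by simp [Fin.sum_univ_three, h]⟩
  · refine ⟨![r (m 1), r (m 0), 0], fun e => h ?_, ?_⟩
    · rw [← hr (m 0), show r (m 0) = 0 from congrFun e 1]
      ring
    · simp only [Fin.sum_univ_three, cons_val_zero, cons_val_one, cons_val_two, tail_cons,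
        head_cons, hr]
      rw [mul_comm, CharTwo.add_self_eq_zero]
      ring

/-- If the matrix of mixed coefficients has rank at most one, the equation of the surface has the
form `G² + l² q` with a linear form `l`, and the surface is singular along the curve
`l = G = 0`. -/
lemma not_exists_eq_vecMulVec_of_isNormal {B : MvPolynomial (Fin 3) K} (hB : B.IsHomogeneous 4)
    (hn : IsNormal (quartic B)) : ¬ ∃ u m, mixedCoeff B = vecMulVec u m := by
  rintro ⟨u, m, hM⟩
  obtain ⟨c, d, hcd⟩ := exists_eq_quarticForm hB
  obtain ⟨r, hr⟩ : ∃ r : K → K, ∀ a, r a ^ 2 = a :=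
    ⟨(frobeniusEquiv K 2).symm, frobeniusEquiv_symm_pow_p K 2⟩
  obtain ⟨x, hx, hmx⟩ := exists_ne_zero_sum_mul_sq_eq_zero m
  obtain ⟨i, hi⟩ := Function.ne_iff.1 hx
  rw [Pi.zero_apply] at hi
  let Q : MvPolynomial (Fin 4) K := ∑ j, C (r (c j)) * X (Fin.castSucc j) ^ 2 +
    ∑ j : Fin 3, C (r (d j)) * (X (j + 1).castSucc * X (j + 2).castSucc)
  let G : MvPolynomial (Fin 4) K := X 3 ^ 2 + X 3 * X 0 + Q
  let l : MvPolynomial (Fin 4) K := ∑ j, C (r (m j)) * X (Fin.castSucc j)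
  let q : MvPolynomial (Fin 4) K :=
    ∑ j : Fin 3, C (u j) * (X (j + 1).castSucc * X (j + 2).castSucc)
  have hF : quartic B = G ^ 2 - l ^ 2 * q := by
    rw [CharTwo.sub_eq_add]
    simp only [G, l, q, Q, CharTwo.add_sq, CharTwo.sum_sq, mul_pow, ← map_pow, hr]
    rw [hcd, hM]
    simp [quartic, quarticForm, Fin.sum_univ_three, vecMulVec_apply]
    ring
  -- the vertical line over a point of `l = 0`
  let y : Fin 3 → K := (x i)⁻¹ • x
  let γ : Fin 4 → Polynomial K := Fin.snoc (fun j => Polynomial.C (y j)) Polynomial.X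
  have hγi : ∀ j : Fin 3, γ j.castSucc = Polynomial.C (y j) := fun j => Fin.snoc_castSucc _ _ _
  have hγ0 : γ 0 = Polynomial.C (y 0) := hγi 0
  have hγ3 : γ 3 = Polynomial.X := Fin.snoc_last _ _
  have hl : aeval γ l = 0 := by
    have hl0 : ∑ j, r (m j) * y j = 0 := by
      refine CharTwo.sq_injective ?_
      simp only [CharTwo.sum_sq, mul_pow, hr, y, Pi.smul_apply, smul_eq_mul]
      rw [zero_pow two_ne_zero, ← mul_zero ((x i)⁻¹ ^ 2), ← hmx, Finset.mul_sum]
      exact Finset.sum_congr rfl fun j _ => by ring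
    simp only [l, map_sum, map_mul, aeval_X, aeval_C, hγi]
    rw [← map_zero Polynomial.C, ← hl0, map_sum]
    exact Finset.sum_congr rfl fun j _ => (map_mul _ _ _).symm
  obtain ⟨k, hk⟩ : ∃ k : K, aeval γ Q = Polynomial.C k := by
    refine ⟨∑ j, r (c j) * y j ^ 2 + ∑ j : Fin 3, r (d j) * (y (j + 1) * y (j + 2)), ?_⟩
    simp [Q, hγi]
  have hG : aeval γ G = Polynomial.X ^ 2 + Polynomial.C (y 0) * Polynomial.X + Polynomial.C k := by
    simp only [G, map_add, map_mul, map_pow, aeval_X, hγ3, hγ0, hk]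
    ring
  have hdeg : (aeval γ G).degree = 2 := by
    rw [hG]
    compute_degree!
  obtain ⟨t, ht⟩ := IsAlgClosed.exists_root (aeval γ G) (by rw [hdeg]; decide)
  refine not_isNormal_of_eq_sq_sub hF i.castSucc γ ?_ hl ?_ ht hn
  · rw [hγi]
    simp [y, hi]
  · intro h0
    rw [h0, Polynomial.degree_zero] at hdeg
    exact absurd hdeg (by decide)

end Normality

/-! ### Integrality -/

section Integrality

open Matrix

lemma exists_eq_sq_add_of_not_irreducible {R : Type*} [CommRing R] [IsDomain R] [CharP R 2]
    {a b : R}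
    (h : ¬ Irreducible (Polynomial.X ^ 4 + Polynomial.C (a ^ 2) * Polynomial.X ^ 2 +
      Polynomial.C b : Polynomial R)) : ∃ s t, b = s ^ 2 + a ^ 2 * t := by
  set p : Polynomial R := Polynomial.X ^ 4 + Polynomial.C (a ^ 2) * Polynomial.X ^ 2 +
      Polynomial.C b with hp
  have h2 : (2 : R) = 0 := CharTwo.two_eq_zero
  have hdeg : p.natDegree = 4 := by
    rw [hp]
    compute_degree!
  have hmon : p.Monic := by
    rw [hp]
    monicity!
  have hp1 : p ≠ 1 := fun e => by simp [e] at hdeg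
  rw [hmon.irreducible_iff_lt_natDegree_lt hp1] at h
  push Not at h
  obtain ⟨q, hq, hqd, r, hr⟩ := h
  have hrm : r.Monic := hq.of_mul_monic_left (hr ▸ hmon)
  have hsum : q.natDegree + r.natDegree = 4 := by
    rw [← hdeg, hr, hq.natDegree_mul hrm]
  rw [hdeg, Finset.mem_Ioc] at hqd
  have hq12 : q.natDegree = 1 ∨ q.natDegree = 2 := by omega
  rcases hq12 with hq1 | hq2
  · -- a root `c` of `p` gives `b = c⁴ + a² c²`
    have hqX := hq.eq_X_add_C hq1
    have hroot : p.eval (q.coeff 0) = 0 := by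
      rw [hr, hqX]
      simp [CharTwo.add_self_eq_zero]
    rw [hp] at hroot
    simp only [Polynomial.eval_add, Polynomial.eval_pow, Polynomial.eval_X, Polynomial.eval_mul,
      Polynomial.eval_C] at hroot
    refine ⟨q.coeff 0 ^ 2, q.coeff 0 ^ 2, ?_⟩
    linear_combination hroot - (q.coeff 0 ^ 4 + a ^ 2 * q.coeff 0 ^ 2) * h2
  · have hr2 : r.natDegree = 2 := by omega
    have hqs := hq.as_sum
    have hrs := hrm.as_sum
    rw [hq2] at hqs
    rw [hr2] at hrs
    simp only [Finset.sum_range_succ, Finset.range_zero, Finset.sum_empty, zero_add, pow_zero,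
      mul_one, pow_one] at hqs hrs
    set v := q.coeff 0
    set u := q.coeff 1
    set y := r.coeff 0
    set w := r.coeff 1
    have hprod : p = Polynomial.X ^ 4 + Polynomial.C (u + w) * Polynomial.X ^ 3 +
        Polynomial.C (v + y + u * w) * Polynomial.X ^ 2 +
        Polynomial.C (u * y + v * w) * Polynomial.X + Polynomial.C (v * y) := by
      rw [hr, hqs, hrs]
      simp only [map_add, map_mul]
      ring
    rw [hp] at hprod
    have c0 := congrArg (fun f => Polynomial.coeff f 0) hprod
    have c1 := congrArg (fun f => Polynomial.coeff f 1) hprod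
    have c2 := congrArg (fun f => Polynomial.coeff f 2) hprod
    have c3 := congrArg (fun f => Polynomial.coeff f 3) hprod
    simp [Polynomial.coeff_X, Polynomial.coeff_X_pow, Polynomial.coeff_C, -map_add, -map_mul,
      -map_pow] at c0 c1 c2 c3
    have huw : u = w := CharTwo.add_eq_zero.1 c3.symm
    rw [← huw] at c1 c2
    have huy : u * (v + y) = 0 := by linear_combination -c1
    rcases mul_eq_zero.1 huy with hu | hvy
    · refine ⟨v, v, ?_⟩
      rw [hu] at c2
      linear_combination c0 - v * c2 - v ^ 2 * h2
    · rw [CharTwo.add_eq_zero] at hvy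
      exact ⟨v, 0, by rw [c0, ← hvy]; ring⟩

variable {K : Type*} [Field K]

/-- Polynomials in `x₁, x₂, x₃, z` as polynomials in `z`. -/
def polynomialEquiv : MvPolynomial (Fin 4) K ≃ₐ[K] Polynomial (MvPolynomial (Fin 3) K) :=
  (renameEquiv K finSuccEquivLast).trans (optionEquivLeft K (Fin 3))

lemma polynomialEquiv_rename (p : MvPolynomial (Fin 3) K) :
    polynomialEquiv (rename Fin.castSucc p) = Polynomial.C p := by
  have : (polynomialEquiv (K := K)).toAlgHom.comp (rename Fin.castSucc) =
      IsScalarTower.toAlgHom K (MvPolynomial (Fin 3) K) _ := by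
    refine algHom_ext fun i => ?_
    simp [polynomialEquiv, optionEquivLeft_X_some]
  exact DFunLike.congr_fun this p

lemma polynomialEquiv_X_three :
    polynomialEquiv (X 3 : MvPolynomial (Fin 4) K) = Polynomial.X := by
  have : finSuccEquivLast (3 : Fin 4) = none := finSuccEquivLast_last
  simp [polynomialEquiv, this, optionEquivLeft_X_none]

lemma polynomialEquiv_quartic (B : MvPolynomial (Fin 3) K) :
    polynomialEquiv (quartic B) =
      Polynomial.X ^ 4 + Polynomial.C (X 0 ^ 2) * Polynomial.X ^ 2 + Polynomial.C B := by
  have h0 : (X 0 : MvPolynomial (Fin 4) K) = rename Fin.castSucc (X 0) := by simp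
  rw [quartic, map_add, map_add, map_mul, map_pow, map_pow, map_pow, polynomialEquiv_rename,
    polynomialEquiv_X_three, h0, polynomialEquiv_rename, map_pow]
  ring

/-- If `B = s² + x₁² t`, then the gradient of `B` vanishes on the line `x₁ = 0`. -/
lemma infinite_criticalLocus [CharP K 2] [Infinite K] {B s t : MvPolynomial (Fin 3) K}
    (hB : B.IsHomogeneous 4) (h : B = s ^ 2 + X 0 ^ 2 * t) : (criticalLocus B).Infinite := by
  have hne : ∀ c : K, (![0, 1, c] : Fin 3 → K) ≠ 0 := fun c e => one_ne_zero (congrFun e 1)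
  refine Set.infinite_of_injective_forall_mem
    (f := fun c : K => Projectivization.mk K ![0, 1, c] (hne c)) ?_ ?_
  · intro c c' e
    obtain ⟨a, ha⟩ := (Projectivization.mk_eq_mk_iff' K _ _ _ _).1 e
    have h1 : a = 1 := by simpa using congrFun ha 1
    have h2 : a * c' = c := congrFun ha 2
    rw [← h2, h1, one_mul]
  · intro c
    rw [mk_mem_criticalLocus_iff hB]
    funext i
    rw [gradAt, h, map_add, pderiv_sq, pderiv_mul, pderiv_sq]
    simp

lemma irreducible_quartic [CharP K 2] [Infinite K] {B : MvPolynomial (Fin 3) K}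
    (hB : B.IsHomogeneous 4) (hfin : (criticalLocus B).Finite) : Irreducible (quartic B) := by
  rw [← MulEquiv.irreducible_iff (polynomialEquiv (K := K)), polynomialEquiv_quartic]
  by_contra h
  obtain ⟨s, t, hst⟩ := exists_eq_sq_add_of_not_irreducible h
  exact infinite_criticalLocus hB hst hfin

lemma isDomain_coordRing [CharP K 2] [Infinite K] {B : MvPolynomial (Fin 3) K}
    (hB : B.IsHomogeneous 4) (hfin : (criticalLocus B).Finite) :
    IsDomain (CoordRing (quartic B)) := by
  have hirr := irreducible_quartic hB hfin
  have := (Ideal.span_singleton_prime hirr.ne_zero).2 hirr.prime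
  exact Ideal.Quotient.isDomain _

/-- The coordinate ring of the plane embeds into that of the surface. -/
lemma mk_rename_ne_zero (B : MvPolynomial (Fin 3) K) {p : MvPolynomial (Fin 3) K} (hp : p ≠ 0) :
    (Ideal.Quotient.mk _ (rename Fin.castSucc p) : CoordRing (quartic B)) ≠ 0 := by
  intro h
  rw [Ideal.Quotient.eq_zero_iff_mem, Ideal.mem_span_singleton] at h
  have hd := map_dvd (polynomialEquiv (K := K)) h
  rw [polynomialEquiv_quartic, polynomialEquiv_rename] at hd
  have hle := Polynomial.natDegree_le_of_dvd hd (Polynomial.C_ne_zero.2 hp)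
  rw [Polynomial.natDegree_C] at hle
  have : (Polynomial.X ^ 4 + Polynomial.C (X 0 ^ 2) * Polynomial.X ^ 2 + Polynomial.C B :
      Polynomial (MvPolynomial (Fin 3) K)).natDegree = 4 := by compute_degree!
  omega

end Integrality

/-! ### Derivations of function fields -/

section Derivations

/-- A derivation of an integral domain extends to its field of fractions: it corresponds to a ring
homomorphism into the dual numbers, under which nonzero elements become units. -/
lemma exists_derivation_extending {K A L : Type*} [Field K] [CommRing A] [Field L]
    [Algebra A L] [IsFractionRing A L] [Algebra K A] [Algebra K L] [IsScalarTower K A L]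
    (D : Derivation K A A) :
    ∃ D' : Derivation K L L, ∀ a, D' (algebraMap A L a) = algebraMap A L (D a) := by
  let φ : A →+* TrivSqZeroExt L L :=
    { toFun := fun a => TrivSqZeroExt.inl (algebraMap A L a) +
        TrivSqZeroExt.inr (algebraMap A L (D a))
      map_one' := by simp
      map_zero' := by simp
      map_add' := fun a b => TrivSqZeroExt.ext (by simp)
        (by simp only [TrivSqZeroExt.snd_add, TrivSqZeroExt.snd_inl, TrivSqZeroExt.snd_inr,
              map_add, zero_add])
      map_mul' := fun a b => TrivSqZeroExt.ext (by simp)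
        (by simp only [TrivSqZeroExt.snd_add, TrivSqZeroExt.snd_inl, TrivSqZeroExt.snd_inr,
              TrivSqZeroExt.snd_mul, TrivSqZeroExt.fst_add, TrivSqZeroExt.fst_inl,
              TrivSqZeroExt.fst_inr, Derivation.leibniz, map_add, map_mul, smul_eq_mul, zero_add,
              add_zero, MulOpposite.smul_eq_mul_unop, MulOpposite.unop_op]
            ring) }
  have hφf : ∀ a, (φ a).fst = algebraMap A L a := fun a => by simp [φ]
  have hφs : ∀ a, (φ a).snd = algebraMap A L (D a) := fun a => by
    change (TrivSqZeroExt.inl _ + TrivSqZeroExt.inr _ : TrivSqZeroExt L L).snd = _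
    rw [TrivSqZeroExt.snd_add, TrivSqZeroExt.snd_inl, TrivSqZeroExt.snd_inr, zero_add]
  have hu : ∀ a : nonZeroDivisors A, IsUnit (φ a) := fun a => by
    rw [TrivSqZeroExt.isUnit_iff_isUnit_fst, hφf]
    exact IsLocalization.map_units L a
  let Ψ : L →+* TrivSqZeroExt L L := IsLocalization.lift hu
  have hΨ : ∀ a, Ψ (algebraMap A L a) = φ a := IsLocalization.lift_eq hu
  have hfst : ∀ x, (Ψ x).fst = x := by
    have : ((TrivSqZeroExt.fstHom ℤ L L).toRingHom.comp Ψ) = RingHom.id L := by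
      refine IsLocalization.ringHom_ext (nonZeroDivisors A) (RingHom.ext fun a => ?_)
      simp [hΨ, hφf]
    exact fun x => DFunLike.congr_fun this x
  have hsnd : ∀ a, (Ψ (algebraMap A L a)).snd = algebraMap A L (D a) := fun a => by
    rw [hΨ, hφs]
  let D' : L →ₗ[K] L :=
    { toFun := fun x => (Ψ x).snd
      map_add' := fun x y => by simp
      map_smul' := fun k x => by
        rw [Algebra.smul_def, map_mul, TrivSqZeroExt.snd_mul, hfst, hfst,
          IsScalarTower.algebraMap_apply K A L, hsnd, D.map_algebraMap, map_zero, smul_zero,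
          add_zero, ← IsScalarTower.algebraMap_apply K A L, smul_eq_mul, ← Algebra.smul_def]
        rfl }
  refine ⟨Derivation.mk' D' fun x y => ?_, hsnd⟩
  change (Ψ (x * y)).snd = x • (Ψ y).snd + y • (Ψ x).snd
  rw [map_mul, TrivSqZeroExt.snd_mul, hfst, hfst, MulOpposite.smul_eq_mul_unop,
    MulOpposite.unop_op, smul_eq_mul, smul_eq_mul, mul_comm (Ψ x).snd]

variable {K L : Type*} [Field K] [Field L] [Algebra K L]

/-- A derivation that vanishes on a subfield vanishes on all elements separable over it. -/
lemma derivation_eq_zero_of_isSeparable (D : Derivation K L L) {E : IntermediateField K L}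
    (hE : ∀ e ∈ E, D e = 0) {a : L} (ha : IsSeparable E a) : D a = 0 := by
  let D₀ : L →ₗ[E] L :=
    { toFun := D
      map_add' := map_add D
      map_smul' := fun e x => by
        change D (e * x) = e * D x
        rw [Derivation.leibniz, hE e e.2, smul_zero, add_zero, smul_eq_mul] }
  let D' : Derivation E L L := Derivation.mk' D₀ fun x y => D.leibniz x y
  have h := D'.map_aeval (minpoly E a) a
  rw [minpoly.aeval, map_zero, smul_eq_mul, eq_comm, mul_eq_zero] at h
  exact h.resolve_left (Polynomial.Separable.aeval_derivative_ne_zero ha (minpoly.aeval E a))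

lemma derivation_eq_zero_of_mem_quotientField (D : Derivation K L L) {ι : Type*} {g : ι → L}
    (hg : ∀ i, D (g i) = 0) {e : L} (he : e ∈ quotientField K g) : D e = 0 := by
  induction he using IntermediateField.adjoin_induction with
  | mem x hx =>
    obtain ⟨i, j, rfl⟩ := hx
    rw [Derivation.leibniz_div, hg, hg]
    simp
  | algebraMap x => exact D.map_algebraMap x
  | add x y _ _ hx hy => rw [map_add, hx, hy, add_zero]
  | inv x _ hx => rw [Derivation.leibniz_inv, hx, smul_zero]
  | mul x y _ _ hx hy => rw [Derivation.leibniz, hx, hy, smul_zero, smul_zero, add_zero]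

lemma div_mem_quotientField {ι : Type*} (g : ι → L) (i j : ι) : g i / g j ∈ quotientField K g :=
  IntermediateField.subset_adjoin _ _ ⟨i, j, rfl⟩

lemma quotientField_le {ι : Type*} {g : ι → L} {E : IntermediateField K L}
    (h : ∀ i j, g i / g j ∈ E) : quotientField K g ≤ E :=
  IntermediateField.adjoin_le_iff.2 (by rintro _ ⟨i, j, rfl⟩; exact h i j)

/-- Quotients of two members of `g` lie in a field `E` if the quotients by a fixed nonzero member
do. -/
lemma quotientField_le_of_div_mem {ι : Type*} {g : ι → L} {E : IntermediateField K L} {c : L}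
    (hc : c ≠ 0) (h : ∀ i, g i / c ∈ E) : quotientField K g ≤ E :=
  quotientField_le fun i j => by
    have := E.div_mem (h i) (h j)
    rwa [div_div_div_cancel_right₀ hc] at this

end Derivations

/-! ### The degree of the gradient map -/

section Degree

open Matrix

variable {K L : Type*} [Field K] [Field L] [Algebra K L]

lemma frobMul_mem (E : IntermediateField K L) (M : Matrix (Fin 3) (Fin 3) K) {x : Fin 3 → L}
    (hx : ∀ i, x i ∈ E) (i : Fin 3) : frobMul (M.map (algebraMap K L)) x i ∈ E :=
  E.sum_mem fun j _ => mul_mem (E.algebraMap_mem _) (pow_mem (hx j) 2)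

lemma cross_mem (E : IntermediateField K L) {x y : Fin 3 → L} (hx : ∀ i, x i ∈ E)
    (hy : ∀ i, y i ∈ E) (i : Fin 3) : (x ⨯₃ y) i ∈ E := by
  rw [cross_apply]
  fin_cases i <;> exact E.sub_mem (E.mul_mem (hx _) (hy _)) (E.mul_mem (hx _) (hy _))

/-- Let `y = x × h` with `h = N x⁽²⁾`, and `w = Nᵀ y`. Then `w` and `y⁽²⁾` are orthogonal to
`x⁽²⁾`, and `w × y⁽²⁾ = det (x, h, N h⁽²⁾) x⁽²⁾`. -/
lemma vecMul_cross_sq [CharP L 2] (N : Matrix (Fin 3) (Fin 3) L) (x : Fin 3 → L) :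
    ((x ⨯₃ frobMul N x) ᵥ* N) ⨯₃ ((x ⨯₃ frobMul N x) ^ 2) = cyclicDet N x • x ^ 2 := by
  obtain ⟨h, hh⟩ : ∃ h, h = frobMul N x := ⟨_, rfl⟩
  obtain ⟨y, hy⟩ : ∃ y, y = x ⨯₃ h := ⟨_, rfl⟩
  obtain ⟨w, hw⟩ : ∃ w, w = y ᵥ* N := ⟨_, rfl⟩
  have hwx : w 0 * x 0 ^ 2 + w 1 * x 1 ^ 2 + w 2 * x 2 ^ 2 = 0 := by
    have h1 : w ⬝ᵥ (x ^ 2) = y ⬝ᵥ h := by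
      rw [hw, ← dotProduct_mulVec, hh]
      rfl
    rw [hy, dotProduct_comm _ h, dot_cross_self] at h1
    simpa [dotProduct, Fin.sum_univ_three] using h1
  have hwh : w 0 * h 0 ^ 2 + w 1 * h 1 ^ 2 + w 2 * h 2 ^ 2 = cyclicDet N x := by
    have h1 : w ⬝ᵥ (h ^ 2) = y ⬝ᵥ frobMul N h := by
      rw [hw, ← dotProduct_mulVec]
      rfl
    have h2 : y ⬝ᵥ frobMul N h = cyclicDet N x := by
      rw [cyclicDet, ← hh, triple_product_permutation, triple_product_permutation,
        dotProduct_comm, hy]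
    rw [h2] at h1
    simpa [dotProduct, Fin.sum_univ_three] using h1
  have hy2 : y ^ 2 = (x ^ 2) ⨯₃ (h ^ 2) := by
    rw [hy, cross_apply, cross_apply]
    funext i
    fin_cases i <;> simp [CharTwo.sub_eq_add, CharTwo.add_sq, mul_pow]
  rw [← hh, ← hy, ← hw, hy2, cross_apply, cross_apply, ← hwh]
  funext i
  fin_cases i <;> simp
  · linear_combination h 0 ^ 2 * hwx * (-1)
  · linear_combination h 1 ^ 2 * hwx * (-1)
  · linear_combination h 2 ^ 2 * hwx * (-1)

lemma cross_ne_zero_of_cyclicDet_ne_zero {N : Matrix (Fin 3) (Fin 3) L} {x : Fin 3 → L}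
    (h : cyclicDet N x ≠ 0) : ∃ k, (x ⨯₃ frobMul N x) k ≠ 0 := by
  by_contra! h0
  rw [cyclicDet, triple_product_permutation, triple_product_permutation,
    show x ⨯₃ frobMul N x = 0 from funext h0, dotProduct_zero] at h
  exact h rfl

variable [CharP L 2]

/-- The squares of the `xᵢ / xⱼ` are rational functions of the ratios of the coordinates of
`y = x × M x⁽²⁾`. -/
lemma div_sq_mem_quotientField (M : Matrix (Fin 3) (Fin 3) K) {x : Fin 3 → L}
    (hκ : cyclicDet (M.map (algebraMap K L)) x ≠ 0) (i j : Fin 3) :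
    (x i / x j) ^ 2 ∈ quotientField K (x ⨯₃ frobMul (M.map (algebraMap K L)) x) := by
  obtain ⟨k, hk⟩ := cross_ne_zero_of_cyclicDet_ne_zero hκ
  set N := M.map (algebraMap K L) with hN
  set y := x ⨯₃ frobMul N x with hy
  set E := quotientField K y
  have hyE : ∀ l, y l / y k ∈ E := fun l => div_mem_quotientField y l k
  have hmem : ∀ l, ((y ᵥ* N) ⨯₃ (y ^ 2)) l / y k ^ 3 ∈ E := by
    intro l
    have h1 := cross_mem E (x := (fun l => y l / y k) ᵥ* N) (y := fun l => (y l / y k) ^ 2)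
      (fun l => by
        change ∑ j, y j / y k * N j l ∈ E
        exact sum_mem fun j _ => mul_mem (hyE j) (E.algebraMap_mem (M j l)))
      (fun l => pow_mem (hyE l) 2) l
    have e1 : (fun l => y l / y k) ᵥ* N = (y k)⁻¹ • (y ᵥ* N) := by
      rw [← smul_vecMul]
      congr 1
      funext l
      exact div_eq_inv_mul _ _
    have e2 : (fun l => (y l / y k) ^ 2) = ((y k)⁻¹ ^ 2) • (y ^ 2) := by
      funext l
      simp [div_eq_inv_mul, mul_pow]
    rw [e1, e2, map_smul, map_smul, LinearMap.smul_apply, smul_smul, Pi.smul_apply,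
      smul_eq_mul] at h1
    convert h1 using 1
    field_simp
  have h := E.div_mem (hmem i) (hmem j)
  rw [div_div_div_cancel_right₀ (pow_ne_zero 3 hk), hy, vecMul_cross_sq] at h
  simp only [Pi.smul_apply, smul_eq_mul, Pi.pow_apply] at h
  rwa [mul_div_mul_left _ _ hκ, ← div_pow] at h

/-- The function field of the plane has degree two over the field generated by the ratios of the
coordinates of `y = x × h`, `h = M x⁽²⁾`, provided that there is a derivation `D` with
`D xᵢ = hᵢ`. It is generated by one ratio `θ = xᵢ / xⱼ`, since `x` is orthogonal to `y`; the square
of `θ` lies in the smaller field, and `θ` does not, since `D` kills the `yᵢ`. -/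
lemma relfinrank_quotientField (M : Matrix (Fin 3) (Fin 3) K) {x : Fin 3 → L}
    (hx : ∀ i, x i ≠ 0) (hκ : cyclicDet (M.map (algebraMap K L)) x ≠ 0)
    (D : Derivation K L L) (hD : ∀ i, D (x i) = frobMul (M.map (algebraMap K L)) x i) :
    IntermediateField.relfinrank
      (quotientField K (x ⨯₃ frobMul (M.map (algebraMap K L)) x)) (quotientField K x) = 2 := by
  obtain ⟨k, hk⟩ := cross_ne_zero_of_cyclicDet_ne_zero hκ
  have hsq := div_sq_mem_quotientField M hκ
  set N := M.map (algebraMap K L) with hN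
  set h := frobMul N x with hh
  have hyx : x ⬝ᵥ (x ⨯₃ h) = 0 := dot_self_cross x h
  set y := x ⨯₃ h with hy
  set E := quotientField K y with hE
  set P := quotientField K x with hP
  have hDh : ∀ i, D (h i) = 0 := by
    intro i
    rw [hh, frobMul, map_sum]
    refine Finset.sum_eq_zero fun j _ => ?_
    rw [hN, Matrix.map_apply, Derivation.leibniz, D.map_algebraMap, D.leibniz_pow, two_nsmul,
      CharTwo.add_self_eq_zero, smul_zero, smul_zero, add_zero]
  have hDy : ∀ i, D (y i) = 0 := by
    intro i
    rw [hy, cross_apply]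
    fin_cases i <;>
    simp only [Fin.zero_eta, Fin.mk_one, Fin.reduceFinMk, cons_val_zero, cons_val_one, cons_val,
      map_sub, Derivation.leibniz, hD, hDh, smul_eq_mul, mul_zero, zero_add] <;> ring
  have hDE : ∀ e ∈ E, D e = 0 := fun e he => derivation_eq_zero_of_mem_quotientField D hDy he
  have hEP : E ≤ P := by
    refine quotientField_le_of_div_mem (c := x 0 ^ 3) (pow_ne_zero 3 (hx 0)) fun i => ?_
    have hxP : ∀ l, x l / x 0 ∈ P := fun l => div_mem_quotientField x l 0
    have h1 := cross_mem P hxP (fun l => frobMul_mem P M hxP l) i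
    have e1 : (fun l => x l / x 0) = (x 0)⁻¹ • x := by
      funext l
      exact div_eq_inv_mul _ _
    rw [e1, frobMul_smul, map_smul, map_smul, LinearMap.smul_apply, smul_smul, Pi.smul_apply,
      smul_eq_mul] at h1
    convert h1 using 1
    have := hx 0
    field_simp
    rfl
  -- the other two indices
  obtain ⟨i, j, hijk, hval⟩ : ∃ i j : Fin 3, (∀ l, l = i ∨ l = j ∨ l = k) ∧
      x i * y i + x j * y j + x k * y k = 0 ∧ (D (x i) * x j - x i * D (x j) = y k ∨
        D (x i) * x j - x i * D (x j) = - y k) := by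
    simp only [hD]
    rw [dotProduct, Fin.sum_univ_three] at hyx
    rw [hy, cross_apply] at hyx ⊢
    fin_cases k
    · refine ⟨1, 2, by decide, ?_, ?_⟩
      · rw [← hyx]
        simp
        ring
      · right
        simp
        ring
    · refine ⟨0, 2, by decide, ?_, ?_⟩
      · rw [← hyx]
        simp
        ring
      · left
        simp
        ring
    · refine ⟨0, 1, by decide, ?_, ?_⟩
      · exact hyx
      · right
        simp
        ring
  obtain ⟨hdot, hDθ⟩ := hval
  set θ := x i / x j with hθ
  have hθE : θ ∉ E := by
    intro hmem
    have h0 := hDE θ hmem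
    rw [hθ, Derivation.leibniz_div, smul_eq_mul, smul_eq_mul, smul_eq_mul, mul_eq_zero] at h0
    have h1 := h0.resolve_left (pow_ne_zero 2 (inv_ne_zero (hx j)))
    rcases hDθ with h2 | h2
    · exact hk (by rw [← h2, ← h1]; ring)
    · exact neg_ne_zero.2 hk (by rw [← h2, ← h1]; ring)
  rw [IntermediateField.relfinrank_eq_finrank_of_le hEP]
  have hgen : IntermediateField.extendScalars hEP = IntermediateField.adjoin E {θ} := by
    refine le_antisymm ?_ ?_
    · have hle : P ≤ (IntermediateField.adjoin E {θ}).restrictScalars K := by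
        have hθmem : θ ∈ (IntermediateField.adjoin E {θ}).restrictScalars K :=
          IntermediateField.mem_adjoin_simple_self E θ
        have hEmem : ∀ e ∈ E, e ∈ (IntermediateField.adjoin E {θ}).restrictScalars K :=
          fun e he => (IntermediateField.adjoin E {θ}).algebraMap_mem ⟨e, he⟩
        have hxj := hx j
        refine quotientField_le_of_div_mem (c := x j) hxj fun l => ?_
        rcases hijk l with rfl | rfl | rfl
        · exact hθmem
        · rw [div_self hxj]
          exact one_mem _
        · have e : x l / x j = -(θ * (y i / y l) + y j / y l) := by
            rw [hθ]
            field_simp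
            linear_combination hdot
          rw [e]
          exact neg_mem (add_mem (mul_mem hθmem (hEmem _ (div_mem_quotientField y i l)))
            (hEmem _ (div_mem_quotientField y j l)))
      exact fun a ha => hle ha
    · rw [IntermediateField.adjoin_simple_le_iff]
      exact div_mem_quotientField x i j
  rw [hgen]
  have hroot : Polynomial.aeval θ (Polynomial.X ^ 2 - Polynomial.C (⟨θ ^ 2, hsq i j⟩ : E)) = 0 := by
    simp [Polynomial.aeval_C]
  have hmonic : (Polynomial.X ^ 2 - Polynomial.C (⟨θ ^ 2, hsq i j⟩ : E)).Monic := by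
    monicity!
  have hint : IsIntegral E θ := ⟨_, hmonic, hroot⟩
  rw [IntermediateField.adjoin.finrank hint]
  refine le_antisymm ?_ ?_
  · refine (Polynomial.natDegree_le_of_dvd (minpoly.dvd E θ hroot) hmonic.ne_zero).trans ?_
    compute_degree
  · rw [minpoly.two_le_natDegree_iff hint]
    rintro ⟨e, he⟩
    exact hθE (he ▸ e.2)

end Degree

/-! ### Function fields of the plane and of the surface -/

section FunctionFieldsOfQuartic

open Matrix

lemma map_cyclicDet {A A' : Type*} [CommRing A] [CommRing A'] (f : A →+* A')
    (M : Matrix (Fin 3) (Fin 3) A) (x : Fin 3 → A) :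
    f (cyclicDet M x) = cyclicDet (M.map f) (fun i => f (x i)) := by
  rw [cyclicDet, cyclicDet, ← map_frobMul, ← map_frobMul, ← map_cross]
  simp [dotProduct]

variable {K : Type*} [Field K]

lemma aeval_mem {L σ : Type*} [Field L] [Algebra K L] (E : IntermediateField K L) {u : σ → L}
    (hu : ∀ i, u i ∈ E) (p : MvPolynomial σ K) : aeval u p ∈ E := by
  induction p using MvPolynomial.induction_on with
  | C a =>
    rw [aeval_C]
    exact E.algebraMap_mem a
  | add p q hp hq =>
    rw [map_add]
    exact add_mem hp hq
  | mul_X p i hp =>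
    rw [map_mul, aeval_X]
    exact mul_mem hp (hu i)

lemma aeval_div {L : Type*} [Field L] [Algebra K L] {B : MvPolynomial (Fin 3) K}
    (hB : B.IsHomogeneous 4) (x : Fin 3 → L) {c : L} (hc : c ≠ 0) :
    aeval (fun i => x i / c) B = aeval x B / c ^ 4 := by
  obtain ⟨a, d, h⟩ := exists_eq_quarticForm hB
  rw [h]
  simp [quarticForm, Fin.sum_univ_three]
  field_simp

lemma div_pow_four_add_div_sq {L : Type*} [Field L] {a b c : L} (hc : c ≠ 0)
    (h : a ^ 4 + a ^ 2 * c ^ 2 + b = 0) : (a / c) ^ 4 + (a / c) ^ 2 = -(b / c ^ 4) := by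
  field_simp
  linear_combination h

variable [CharP K 2] [IsAlgClosed K]

/-- A rank condition on the matrix `M` implies that `det (x, φ x, φ² x)` is nonzero as a polynomial
in the coordinates. -/
lemma cyclicDet_X_ne_zero {M : Matrix (Fin 3) (Fin 3) K} (hM : ¬ ∃ u m, M = vecMulVec u m) :
    cyclicDet (M.map C) (X : Fin 3 → MvPolynomial (Fin 3) K) ≠ 0 := by
  obtain ⟨x, hx⟩ := exists_cyclicDet_ne_zero hM
  intro h
  refine hx ?_
  have := congrArg (eval x) h
  rw [map_cyclicDet, map_zero] at this
  simpa [Matrix.map_map, Function.comp_def] using this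

lemma gradientMapDegree_eq_two {B : MvPolynomial (Fin 3) K} (hB : B.IsHomogeneous 4)
    (hM : ¬ ∃ u m, mixedCoeff B = vecMulVec u m) : gradientMapDegree B = 2 := by
  set M := mixedCoeff B with hMdef
  let A := MvPolynomial (Fin 3) K
  let L := FractionRing A
  have hchar : CharP L 2 := charP_of_injective_algebraMap (algebraMap K L).injective 2
  let x : Fin 3 → L := fun i => algebraMap A L (X i)
  have hinj : Function.Injective (algebraMap A L) := IsFractionRing.injective A L
  have hmap : (M.map C).map (algebraMap A L) = M.map (algebraMap K L) := by
    ext i j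
    exact (IsScalarTower.algebraMap_apply K A L (M i j)).symm
  have hh : (fun i => algebraMap A L (frobMul (M.map C) X i)) =
      frobMul (M.map (algebraMap K L)) x := by
    rw [map_frobMul, hmap]
  have hy : (fun i => algebraMap A L (pderiv i B)) =
      x ⨯₃ frobMul (M.map (algebraMap K L)) x := by
    have h1 : ∀ i, pderiv i B = (X ⨯₃ frobMul (M.map C) X) i := fun i =>
      congrFun (pderiv_eq_cross hB) i
    simp only [h1]
    rw [map_cross, hh]
  have hκ : cyclicDet (M.map (algebraMap K L)) x ≠ 0 := by
    rw [← hmap, ← map_cyclicDet]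
    exact (map_ne_zero_iff _ hinj).2 (cyclicDet_X_ne_zero hM)
  have hx : ∀ i, x i ≠ 0 := fun i => (map_ne_zero_iff _ hinj).2 (X_ne_zero i)
  -- the vector field `∑ hᵢ ∂ᵢ`
  obtain ⟨D, hD⟩ := exists_derivation_extending (L := L)
    (mkDerivation K (frobMul (M.map C) X) : Derivation K A A)
  have hDx : ∀ i, D (x i) = frobMul (M.map (algebraMap K L)) x i := fun i => by
    rw [← congrFun hh i, hD, mkDerivation_X]
  have := relfinrank_quotientField M hx hκ D hDx
  rw [← hy] at this
  exact this

/-- Over the function field of the image of the Gauss map, the function field of the surface is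
generated by the square roots `xᵢ / xⱼ` of elements and by `z / x₁`. The derivation `∂/∂z` acts on
the function field, since the equation of the surface is a polynomial in `z²`; it kills the partial
derivatives of the equation but not `z / x₁`. -/
lemma gaussMapInseparable {B : MvPolynomial (Fin 3) K} (hB : B.IsHomogeneous 4)
    (hfin : (criticalLocus B).Finite) (hM : ¬ ∃ u m, mixedCoeff B = vecMulVec u m) :
    GaussMapInseparable (quartic B) := by
  have hdom := isDomain_coordRing hB hfin
  refine ⟨hdom, ?_⟩
  set M := mixedCoeff B with hMdef
  let A := CoordRing (quartic B)
  let L := FractionRing A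
  let π : MvPolynomial (Fin 4) K →ₐ[K] A := Ideal.Quotient.mkₐ K _
  have hinj : Function.Injective (algebraMap A L) := IsFractionRing.injective A L
  let τ : MvPolynomial (Fin 4) K →ₐ[K] L := (IsScalarTower.toAlgHom K A L).comp π
  let σ : MvPolynomial (Fin 3) K →ₐ[K] L := τ.comp (rename Fin.castSucc)
  have hσ : ∀ p, p ≠ 0 → σ p ≠ 0 := fun p hp =>
    (map_ne_zero_iff _ hinj).2 (mk_rename_ne_zero B hp)
  intro L' toL KX E
  have hchar : CharP L 2 := charP_of_injective_algebraMap (algebraMap K L).injective 2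
  let x : Fin 3 → L := fun i => σ (X i)
  have hx : ∀ i, x i ≠ 0 := fun i => hσ _ (X_ne_zero i)
  have hxτ : ∀ i : Fin 3, τ (X i.castSucc) = x i := fun i => by
    simp [x, σ]
  have hx0 : τ (X 0) = x 0 := hxτ 0
  have hσB : ∀ p, σ p = aeval x p := fun p => by
    have : σ = aeval x := algHom_ext fun i => by simp [x]
    rw [this]
  have hτF : τ (quartic B) = 0 := by
    have : π (quartic B) = 0 := Ideal.Quotient.eq_zero_iff_mem.2 (Ideal.mem_span_singleton_self _)
    simp only [τ, AlgHom.comp_apply, this, map_zero]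
  have hmap : (M.map C).map σ = M.map (algebraMap K L) := by
    ext i j
    exact σ.commutes (M i j)
  have hy : (fun i => σ (pderiv i B)) = x ⨯₃ frobMul (M.map (algebraMap K L)) x := by
    have h1 : ∀ i, pderiv i B = (X ⨯₃ frobMul (M.map C) X) i := fun i =>
      congrFun (pderiv_eq_cross hB) i
    simp only [h1]
    rw [← hmap]
    exact (map_cross σ.toRingHom _ _).trans (congrArg _ (map_frobMul σ.toRingHom _ _))
  have hκ : cyclicDet (M.map (algebraMap K L)) x ≠ 0 := by
    have h1 := map_cyclicDet σ.toRingHom (M.map C) X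
    rw [← hmap]
    exact fun h => hσ _ (cyclicDet_X_ne_zero hM) (h1.trans h)
  have hEle : quotientField K (x ⨯₃ frobMul (M.map (algebraMap K L)) x) ≤ E := by
    rw [← hy]
    refine quotientField_le fun i j => ?_
    have : ∀ i : Fin 3, σ (pderiv i B) = toL (pderiv i.castSucc (quartic B)) := fun i => by
      rw [pderiv_castSucc_quartic]
      rfl
    rw [this, this]
    exact div_mem_quotientField (fun i => toL (pderiv i (quartic B))) i.castSucc j.castSucc
  set ζ : L := τ (X 3) / x 0 with hζ
  have hζeq : ζ ^ 4 + ζ ^ 2 = - aeval (fun i => x i / x 0) B := by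
    have h1 : τ (X 3 ^ 4 + X 3 ^ 2 * X 0 ^ 2 + rename Fin.castSucc B) = 0 := hτF
    have h2 : τ (rename Fin.castSucc B) = aeval x B := hσB B
    rw [map_add, map_add, map_mul, map_pow, map_pow, map_pow, hx0, h2] at h1
    rw [aeval_div hB x (hx 0)]
    exact div_pow_four_add_div_sq (hx 0) h1
  have hζmem : ζ ∈ KX := by
    rw [hζ, ← hx0]
    exact div_mem_quotientField (fun i => toL (X i)) 3 0
  refine ⟨?_, ζ, hζmem, ?_⟩
  · have hxalg : ∀ i, x i / x 0 ∈ algebraicClosure E L := fun i => by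
      rw [mem_algebraicClosure_iff]
      refine IsAlgebraic.of_pow two_pos ?_
      exact isAlgebraic_algebraMap (⟨_, hEle (div_sq_mem_quotientField M hκ i 0)⟩ : E)
    have hζalg : ζ ∈ algebraicClosure E L := by
      rw [mem_algebraicClosure_iff]
      refine IsAlgebraic.of_aeval (Polynomial.X ^ 4 + Polynomial.X ^ 2) ?_ ?_ ?_
      · have : (Polynomial.X ^ 4 + Polynomial.X ^ 2 : Polynomial E).natDegree = 4 := by
          compute_degree!
        omega
      · have : (Polynomial.X ^ 4 + Polynomial.X ^ 2 : Polynomial E).Monic := by monicity!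
        rw [this.leadingCoeff]
        exact one_mem _
      · simp only [map_add, map_pow, Polynomial.aeval_X]
        rw [hζeq, ← mem_algebraicClosure_iff]
        exact neg_mem (aeval_mem ((algebraicClosure E L).restrictScalars K) hxalg B)
    have hle : KX ≤ (algebraicClosure E L).restrictScalars K := by
      refine quotientField_le_of_div_mem (c := x 0) (hx 0) fun i => ?_
      refine Fin.lastCases ?_ (fun i => ?_) i
      · exact hζalg
      · change τ (X i.castSucc) / x 0 ∈ algebraicClosure E L
        rw [hxτ]
        exact hxalg i
    exact fun a ha => mem_algebraicClosure_iff.1 (hle ha)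
  · intro hsep
    have hker : ∀ p, π p = 0 → π (pderiv 3 p) = 0 := by
      intro p hp
      obtain ⟨q, rfl⟩ := Ideal.mem_span_singleton.1 (Ideal.Quotient.eq_zero_iff_mem.1 hp)
      have hF : π (quartic B) = 0 :=
        Ideal.Quotient.eq_zero_iff_mem.2 (Ideal.mem_span_singleton_self _)
      rw [pderiv_mul, pderiv_three_quartic, zero_mul, zero_add, map_mul, hF, zero_mul]
    have hπ : Function.Surjective π := Ideal.Quotient.mk_surjective
    obtain ⟨D₀, hD₀⟩ : ∃ D₀ : Derivation K A A, ∀ p, D₀ (π p) = π (pderiv 3 p) :=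
      ⟨Derivation.liftOfSurjective (f := π) hπ hker,
        Derivation.liftOfSurjective_apply (f := π) hπ hker⟩
    obtain ⟨D, hD⟩ := exists_derivation_extending (L := L) D₀
    have hDτ : ∀ p, D (τ p) = τ (pderiv 3 p) := fun p =>
      (hD (π p)).trans (congrArg (algebraMap A L) (hD₀ p))
    have hDσ : ∀ p, D (σ p) = 0 := fun p => by
      have h3 : pderiv 3 (rename Fin.castSucc p : MvPolynomial (Fin 4) K) = 0 := by
        classical
        refine pderiv_eq_zero_of_notMem_vars fun hm => ?_
        obtain ⟨i, -, hi⟩ := Finset.mem_image.1 (vars_rename _ _ hm)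
        exact absurd hi (Fin.castSucc_lt_last i).ne
      change D (τ (rename Fin.castSucc p)) = 0
      rw [hDτ, h3, map_zero]
    have hDE : ∀ e ∈ E, D e = 0 := by
      refine fun e he => derivation_eq_zero_of_mem_quotientField D (fun i => ?_) he
      change D (τ (pderiv i (quartic B))) = 0
      refine Fin.lastCases ?_ (fun i => ?_) i
      · rw [show pderiv (Fin.last 3) (quartic B) = 0 from pderiv_three_quartic B, map_zero,
          map_zero]
      · rw [pderiv_castSucc_quartic]
        exact hDσ _
    have h0 := derivation_eq_zero_of_isSeparable D hDE hsep
    rw [hζ, Derivation.leibniz_div_const _ _ _ (hDσ _), hDτ, pderiv_X_self, map_one, smul_eq_mul,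
      mul_one] at h0
    exact inv_ne_zero (hx 0) h0

end FunctionFieldsOfQuartic

/-! ### Surfaces with fourteen singular points -/

section Fourteen

open Matrix

variable {K : Type*} [Field K] [CharP K 2] {B : MvPolynomial (Fin 3) K}

/-- A polynomial in the matrix of mixed coefficients; if it does not vanish, then no critical
point lies on the line `x₁ = 0`. -/
def offLine {A : Type*} [CommRing A] (M : Matrix (Fin 3) (Fin 3) A) : A :=
  M 0 2 * (M 2 1 * M 0 2 + M 2 2 * M 0 1) ^ 2 + M 0 1 * (M 1 1 * M 0 2 + M 1 2 * M 0 1) ^ 2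

/-- On the line `x₁ = 0`, a critical point is given by `M₀₁ x₂² + M₀₂ x₃² = 0` and
`x₂ h₂ + x₃ h₁ = 0`; eliminate `(x₂², x₃²) ∥ (M₀₂, M₀₁)`. -/
lemma rep_zero_ne_zero_of_offLine_ne_zero (hB : B.IsHomogeneous 4)
    (h : offLine (mixedCoeff B) ≠ 0) {Q : ℙ K (Fin 3 → K)} (hQ : Q ∈ criticalLocus B) :
    Q.rep 0 ≠ 0 := by
  intro h0
  have h2 : (2 : K) = 0 := CharTwo.two_eq_zero
  rw [criticalLocus_eq_eigenlines hB, eigenlines, Set.mem_ofPred_eq, cross_apply] at hQ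
  set M := mixedCoeff B
  have hne := Q.rep_nonzero
  set x := Q.rep
  have e0 := congrFun hQ 0
  have e1 := congrFun hQ 1
  have e2 := congrFun hQ 2
  simp [frobMul, Fin.sum_univ_three, h0, CharTwo.sub_eq_add] at e0 e1 e2
  have hx12 : x 1 ≠ 0 ∨ x 2 ≠ 0 := by
    by_contra! hc
    refine hne (funext fun i => ?_)
    fin_cases i
    · exact h0
    · exact hc.1
    · exact hc.2
  have e3 : M 0 1 * x 1 ^ 2 + M 0 2 * x 2 ^ 2 = 0 := by
    rcases hx12 with hx | hx
    · exact e2.resolve_left hx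
    · exact e1.resolve_left hx
  -- squares are additive in characteristic two
  have e4 : x 1 ^ 2 * (M 2 1 * x 1 ^ 2 + M 2 2 * x 2 ^ 2) ^ 2 +
      x 2 ^ 2 * (M 1 1 * x 1 ^ 2 + M 1 2 * x 2 ^ 2) ^ 2 = 0 := by
    rw [← mul_pow, ← mul_pow, ← CharTwo.add_sq, e0]
    ring
  have e5 : M 0 1 * x 1 ^ 2 = M 0 2 * x 2 ^ 2 := by
    linear_combination e3 - M 0 2 * x 2 ^ 2 * h2
  have key : ∀ u v p q : K, u ≠ 0 → q * u = p * v →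
      u * (M 2 1 * u + M 2 2 * v) ^ 2 + v * (M 1 1 * u + M 1 2 * v) ^ 2 = 0 →
      p * (M 2 1 * p + M 2 2 * q) ^ 2 + q * (M 1 1 * p + M 1 2 * q) ^ 2 = 0 := by
    intro u v p q hu hq he
    obtain rfl : q = p * v / u := by rw [← hq, mul_div_cancel_right₀ _ hu]
    field_simp
    linear_combination p ^ 3 * he
  refine h ?_
  rw [offLine]
  rcases hx12 with hx | hx
  · exact key _ _ _ _ (pow_ne_zero 2 hx) e5 e4
  · obtain ⟨v, hv⟩ : ∃ v, v = x 1 ^ 2 := ⟨_, rfl⟩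
    obtain ⟨u, hu⟩ : ∃ u, u = x 2 ^ 2 := ⟨_, rfl⟩
    have hu0 : u ≠ 0 := hu ▸ pow_ne_zero 2 hx
    rw [← hv, ← hu] at e4 e5
    have hp : M 0 2 = M 0 1 * v / u := by rw [e5, mul_div_cancel_right₀ _ hu0]
    rw [hp]
    field_simp
    linear_combination M 0 1 ^ 3 * e4

variable [IsAlgClosed K]

lemma encard_criticalLocus_le (hB : B.IsHomogeneous 4)
    (hM : ¬ ∃ u m, mixedCoeff B = vecMulVec u m) : (criticalLocus B).encard ≤ 7 := by
  rw [criticalLocus_eq_eigenlines hB]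
  exact encard_eigenlines_le hM

lemma encard_singularLocus_le (hB : B.IsHomogeneous 4)
    (hM : ¬ ∃ u m, mixedCoeff B = vecMulVec u m) : (singularLocus (quartic B)).encard ≤ 14 := by
  have h7 := encard_criticalLocus_le hB hM
  rw [encard_singularLocus hB]
  calc _ ≤ (7 : ℕ∞) + 7 := add_le_add h7 ((Set.encard_le_encard (Set.sep_subset _ _)).trans h7)
    _ = 14 := by norm_num

/-- Fourteen singular points force seven critical points of `B`, none of them on `x₁ = 0`; the
semilinear map is then injective, so that the Hessian does not vanish at the critical points. -/
lemma isNode_of_encard_eq (hB : B.IsHomogeneous 4)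
    (hM : ¬ ∃ u m, mixedCoeff B = vecMulVec u m)
    (h14 : (singularLocus (quartic B)).encard = 14) {P : ℙ K (Fin 4 → K)}
    (hP : P ∈ singularLocus (quartic B)) : IsNode (quartic B) P := by
  have h7 := encard_criticalLocus_le hB hM
  have hfin : (criticalLocus B).Finite := Set.finite_of_encard_le_coe h7
  have hsub : {Q ∈ criticalLocus B | Q.rep 0 ≠ 0} ⊆ criticalLocus B := Set.sep_subset _ _
  have hle := Set.encard_le_encard hsub
  rw [encard_singularLocus hB, hfin.encard_eq_coe_toFinset_card,
    (hfin.subset hsub).encard_eq_coe_toFinset_card] at h14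
  rw [hfin.encard_eq_coe_toFinset_card] at h7 hle
  rw [(hfin.subset hsub).encard_eq_coe_toFinset_card] at hle
  norm_cast at h14 h7 hle
  have hcard : (criticalLocus B).encard = 7 := by
    rw [hfin.encard_eq_coe_toFinset_card]
    norm_cast
    omega
  have heq : {Q ∈ criticalLocus B | Q.rep 0 ≠ 0} = criticalLocus B := by
    refine (hfin.subset hsub).eq_of_subset_of_encard_le hsub ?_
    rw [hfin.encard_eq_coe_toFinset_card, (hfin.subset hsub).encard_eq_coe_toFinset_card]
    norm_cast
    omega
  obtain ⟨-, hx, hc⟩ := (mem_singularLocus_iff hB P).1 hP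
  rw [← heq] at hc
  obtain ⟨a, ha⟩ := Projectivization.exists_smul_eq_mk_rep K (xPart P) hx
  refine isNode_of_frobMul_ne_zero hB hP (fun h0 => hc.2 ?_) ?_
  · have h1 := congrFun ha 0
    have h2 : xPart P 0 = 0 := h0
    rw [Pi.smul_apply, h2, smul_zero] at h1
    exact h1.symm
  · refine frobMul_ne_zero_of_encard_eigenlines hM ?_ hx
    rw [← criticalLocus_eq_eigenlines hB, hcard]

lemma degree_mixedExponent (i j : Fin 3) : (mixedExponent i j).degree = 4 := by
  rw [Finsupp.degree_eq_sum]
  revert i j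
  simp only [mixedExponent, Finsupp.coe_equivFunOnFinite_symm]
  decide

/-- The monomials that are not squares, as indices of coefficients of quartic forms. -/
def mixedMonomial (p : Fin 3 × Fin 3) : QuarticMonomial :=
  ⟨mixedExponent p.1 p.2, degree_mixedExponent p.1 p.2⟩

lemma mixedMonomial_injective : Function.Injective mixedMonomial := by
  intro p q h
  have h1 : mixedExponent p.1 p.2 = mixedExponent q.1 q.2 := congrArg Subtype.val h
  have h2 := Finsupp.equivFunOnFinite.symm.injective h1
  clear h h1
  revert p q
  decide

/-- The condition `det M ≠ 0` ensures seven critical points, and `offLine M ≠ 0` ensures that none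
of them lies on the line `x₁ = 0`. Both hold for a cyclic permutation matrix. -/
lemma forGeneralQuarticForm_encard_eq : ForGeneralQuarticForm (fun B : MvPolynomial (Fin 3) K =>
    (singularLocus (quartic B)).encard = 14 ∧
      ∀ P ∈ singularLocus (quartic B), IsNode (quartic B) P) := by
  let N : Matrix (Fin 3) (Fin 3) (MvPolynomial QuarticMonomial K) :=
    Matrix.of fun i j => X (mixedMonomial (i, j))
  have heval : ∀ v : QuarticMonomial → K, eval v (N.det * offLine N) =
      (Matrix.of fun i j => v (mixedMonomial (i, j))).det *
        offLine (Matrix.of fun i j => v (mixedMonomial (i, j))) := by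
    intro v
    simp [offLine, Matrix.det_fin_three, N]
  refine ⟨N.det * offLine N, ?_, ?_⟩
  · intro h
    have h1 := heval (Function.extend mixedMonomial
      (fun p => (!![0, 0, 1; 1, 0, 0; 0, 1, 0] : Matrix (Fin 3) (Fin 3) K) p.1 p.2) 0)
    rw [h, map_zero] at h1
    simp [mixedMonomial_injective.extend_apply, offLine, Matrix.det_fin_three] at h1
  · intro B hB h
    rw [heval] at h
    obtain ⟨hdet, hoff⟩ := mul_ne_zero_iff.1 h
    change (mixedCoeff B).det ≠ 0 at hdet
    change offLine (mixedCoeff B) ≠ 0 at hoff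
    have hM : ¬ ∃ u m, mixedCoeff B = vecMulVec u m := by
      rintro ⟨u, m, hum⟩
      exact hdet (hum ▸ det_vecMulVec u m)
    have h7 : (criticalLocus B).encard = 7 := by
      rw [criticalLocus_eq_eigenlines hB]
      exact encard_eigenlines_of_det_ne_zero hdet
    have heq : {Q ∈ criticalLocus B | Q.rep 0 ≠ 0} = criticalLocus B :=
      Set.sep_eq_self_iff_mem_true.2 fun Q hQ => rep_zero_ne_zero_of_offLine_ne_zero hB hoff hQ
    have h14 : (singularLocus (quartic B)).encard = 14 := by
      rw [encard_singularLocus hB, heq, h7]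
      norm_num
    exact ⟨h14, fun P hP => isNode_of_encard_eq hB hM h14 hP⟩

end Fourteen

end NormalQuartic

end

theorem mainTheorem12 (K : Type*) [Field K] [IsAlgClosed K] [CharP K 2] :
    (∀ B : MvPolynomial (Fin 3) K, B.IsHomogeneous 4 →
      NormalQuartic.IsNormal (NormalQuartic.quartic B) →
        -- the critical locus of `B` has at most 7 points, the singular locus is its inverse image
        -- in the surface, and it has at most 14 points
        (NormalQuartic.criticalLocus B).encard ≤ 7 ∧
        (∀ P : ℙ K (Fin 4 → K), P ∈ NormalQuartic.singularLocus (NormalQuartic.quartic B) ↔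
          P ∈ NormalQuartic.zeroLocus (NormalQuartic.quartic B) ∧
            ∃ hP : NormalQuartic.xPart P ≠ 0,
              NormalQuartic.proj P hP ∈ NormalQuartic.criticalLocus B) ∧
        (NormalQuartic.singularLocus (NormalQuartic.quartic B)).encard ≤ 14 ∧
        -- the Gauss map is inseparable, and it is the composition of the projection
        -- `(x, z) ↦ x`, the map `x ↦ ∇B(x)` of degree two, and the inclusion of a plane
        NormalQuartic.GaussMapInseparable (NormalQuartic.quartic B) ∧
        (∀ P : {P : ℙ K (Fin 4 → K) // P ∈ NormalQuartic.zeroLocus (NormalQuartic.quartic B) ∧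
            P ∉ NormalQuartic.singularLocus (NormalQuartic.quartic B)},
          ∃ (hx : NormalQuartic.xPart P.1 ≠ 0)
            (hc : NormalQuartic.proj P.1 hx ∉ NormalQuartic.criticalLocus B),
            NormalQuartic.gaussMap (NormalQuartic.quartic B) P =
              NormalQuartic.planeInclusion
                (NormalQuartic.gradientMap B (NormalQuartic.proj P.1 hx) hc)) ∧
        NormalQuartic.gradientMapDegree B = 2 ∧
        -- if there are 14 singular points, they are nodes
        ((NormalQuartic.singularLocus (NormalQuartic.quartic B)).encard = 14 →
          ∀ P ∈ NormalQuartic.singularLocus (NormalQuartic.quartic B),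
            NormalQuartic.IsNode (NormalQuartic.quartic B) P)) ∧
    -- for general `B` there are exactly 14 singular points, and they are nodes
    NormalQuartic.ForGeneralQuarticForm (fun B : MvPolynomial (Fin 3) K =>
      (NormalQuartic.singularLocus (NormalQuartic.quartic B)).encard = 14 ∧
        ∀ P ∈ NormalQuartic.singularLocus (NormalQuartic.quartic B),
          NormalQuartic.IsNode (NormalQuartic.quartic B) P) := by
  refine ⟨fun B hB hn => ?_, NormalQuartic.forGeneralQuarticForm_encard_eq⟩
  have hM := NormalQuartic.not_exists_eq_vecMulVec_of_isNormal hB hn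
  have h7 := NormalQuartic.encard_criticalLocus_le hB hM
  have hfin : (NormalQuartic.criticalLocus B).Finite := Set.finite_of_encard_le_coe h7
  exact ⟨h7, NormalQuartic.mem_singularLocus_iff hB, NormalQuartic.encard_singularLocus_le hB hM,
    NormalQuartic.gaussMapInseparable hB hfin hM, NormalQuartic.gaussMap_quartic hB,
    NormalQuartic.gradientMapDegree_eq_two hB hM,
    fun h14 P hP => NormalQuartic.isNode_of_encard_eq hB hM h14 hP⟩
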